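/- Let $\Gamma\subset\mathbb R$ be a closed bounded set of Lebesgue measure zero. Call $\chi\in C_0^\infty(\mathbb R)$ with $\chi'\in C_0^\infty(\mathbb R\setminus\Gamma)$ a cutting function. Let $A$ be a Schrödinger operator with $\delta'$-interaction on $\Gamma$, that is, a self-adjoint operator on $L_2(\mathbb R)$ (complex-valued functions) such that (i) $A$ extends the minimal operator $\varphi\mapsto-\varphi''$, $\varphi\in C_0^\infty(\mathbb R\setminus\Gamma)$; (ii) $A$ is local: $\chi u\in\mathfrak D(A)$ for every $u\in\mathfrak D(A)$ and every cutting function $\chi$; (iii) $A$ is non-splitting: for no $x_0\in\Gamma$ is $A=A_1\oplus A_2$ with self-adjoint operators $A_1$ on $L_2(-\infty,x_0)$ and $A_2$ on $L_2(x_0,\infty)$; (iv) every cutting function belongs to $\mathfrak D(A)$. An isolated point $x_0$ of $\Gamma$ has intensity $\beta\in\mathbb R$ if every $\psi\in\mathfrak D(A)$ (taken as its representative that is differentiable in a punctured neighbourhood of $x_0$) has one-sided limits $\psi(x_0\pm0)$, $\psi'(x_0\pm0)$ satisfying $$\psi'(x_0+0)=\psi'(x_0-0),\qquad \psi(x_0+0)-\psi(x_0-0)=\tfrac{\beta}{2}\bigl[\psi'(x_0+0)+\psi'(x_0-0)\bigr].$$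 Suppose that the negative spectrum of $A$ is discrete: every $\lambda\in\sigma(A)$ with $\lambda<0$ is an isolated point of $\sigma(A)$ and an eigenvalue of finite multiplicity. Then the number of negative eigenvalues of $A$, counted with multiplicity and possibly infinite, is at least the number (possibly infinite) of isolated points of $\Gamma$ with negative intensity. -/

import Mathlib

open MeasureTheory Filter Topology Set
open scoped ContDiff

namespace DeltaPrime

/-- The complex Hilbert space `L₂(ℝ)`. -/
abbrev L2R : Type := Lp ℂ 2 (volume : Measure ℝ)

/-- The complex Hilbert space `L₂(S)` for a set `S ⊆ ℝ`. -/
abbrev L2On (S : Set ℝ) : Type := Lp ℂ 2 ((volume : Measure ℝ).restrict S)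

/-- Restriction of functions, `L₂(ℝ) → L₂(S)`. -/
noncomputable def restr (S : Set ℝ) : L2R →L[ℂ] L2On S :=
  LpToLpRestrictCLM ℝ ℂ ℂ (volume : Measure ℝ) 2 S

/-- `φ ∈ C₀^∞(U)`: smooth, with compact support contained in `U`. -/
def IsTestFunction (U : Set ℝ) (φ : ℝ → ℂ) : Prop :=
  ContDiff ℝ ∞ φ ∧ HasCompactSupport φ ∧ tsupport φ ⊆ U

/-- `χ ∈ C₀^∞(ℝ)` with `χ' ∈ C₀^∞(ℝ ∖ Γ)`. -/
def IsCutoff (Γ : Set ℝ) (χ : ℝ → ℂ) : Prop :=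
  IsTestFunction univ χ ∧ IsTestFunction Γᶜ (deriv χ)

/-- `A` extends the minimal operator `φ ↦ -φ''`, `φ ∈ C₀^∞(ℝ ∖ Γ)`. -/
def ExtendsMinimal (Γ : Set ℝ) (A : L2R →ₗ.[ℂ] L2R) : Prop :=
  ∀ φ : ℝ → ℂ, IsTestFunction Γᶜ φ → ∀ u v : L2R,
    (u : ℝ → ℂ) =ᵐ[volume] φ →
    (v : ℝ → ℂ) =ᵐ[volume] (fun x => -deriv (deriv φ) x) →
    (u, v) ∈ A.graph

/-- `A` defines a local interaction on `Γ`: its domain is stable under multiplication by every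
cutting function. -/
def IsLocal (Γ : Set ℝ) (A : L2R →ₗ.[ℂ] L2R) : Prop :=
  ∀ u ∈ A.domain, ∀ χ : ℝ → ℂ, IsCutoff Γ χ → ∀ w : L2R,
    (w : ℝ → ℂ) =ᵐ[volume] (fun x => χ x * u x) → w ∈ A.domain

/-- `A` admits splitting boundary conditions at `x₀`: under the decomposition
`L₂(ℝ) = L₂(-∞, x₀) ⊕ L₂(x₀, ∞)` it is the direct sum of two self-adjoint operators. -/
def SplitsAt (A : L2R →ₗ.[ℂ] L2R) (x₀ : ℝ) : Prop :=
  ∃ (A₁ : L2On (Iio x₀) →ₗ.[ℂ] L2On (Iio x₀)) (A₂ : L2On (Ioi x₀) →ₗ.[ℂ] L2On (Ioi x₀)),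
    IsSelfAdjoint A₁ ∧ IsSelfAdjoint A₂ ∧
    ∀ u v : L2R, (u, v) ∈ A.graph ↔
      (restr (Iio x₀) u, restr (Iio x₀) v) ∈ A₁.graph ∧
      (restr (Ioi x₀) u, restr (Ioi x₀) v) ∈ A₂.graph

/-- `A` is a (self-adjoint) Schrödinger operator with `δ'`-interaction on `Γ`. -/
structure IsDeltaPrimeInteraction (Γ : Set ℝ) (A : L2R →ₗ.[ℂ] L2R) : Prop where
  selfAdjoint : IsSelfAdjoint A
  extendsMinimal : ExtendsMinimal Γ A
  isLocal : IsLocal Γ A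
  nonSplitting : ∀ x₀ ∈ Γ, ¬ SplitsAt A x₀
  cutoff_mem : ∀ χ : ℝ → ℂ, IsCutoff Γ χ → ∀ w : L2R,
    (w : ℝ → ℂ) =ᵐ[volume] χ → w ∈ A.domain

/-- `x₀` is an isolated point of `Γ`. -/
def IsIsolatedPoint (Γ : Set ℝ) (x₀ : ℝ) : Prop :=
  x₀ ∈ Γ ∧ ¬ AccPt x₀ (𝓟 Γ)

/-- The boundary conditions of the point `δ'`-interaction of intensity `β` at `x₀`:
`f'(x₀+0) = f'(x₀-0)` and `f(x₀+0) - f(x₀-0) = β (f'(x₀+0) + f'(x₀-0)) / 2`, where the one-sided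
boundary values are required to exist. -/
def DeltaPrimeCondition (f : ℝ → ℂ) (x₀ β : ℝ) : Prop :=
  ∃ a b c d : ℂ,
    Tendsto f (𝓝[>] x₀) (𝓝 a) ∧ Tendsto f (𝓝[<] x₀) (𝓝 b) ∧
    Tendsto (deriv f) (𝓝[>] x₀) (𝓝 c) ∧ Tendsto (deriv f) (𝓝[<] x₀) (𝓝 d) ∧
    c = d ∧ a - b = (β : ℂ) * ((c + d) / 2)

/-- `β` is the intensity of the `δ'`-interaction at the point `x₀`: every function of the domain
(through its representative that is differentiable in a punctured neighbourhood of `x₀`) satisfies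
the boundary conditions with this `β`. -/
def HasIntensity (A : L2R →ₗ.[ℂ] L2R) (x₀ β : ℝ) : Prop :=
  ∀ u ∈ A.domain, ∃ f : ℝ → ℂ, (u : ℝ → ℂ) =ᵐ[volume] f ∧
    (∀ᶠ x in 𝓝[≠] x₀, DifferentiableAt ℝ f x) ∧ DeltaPrimeCondition f x₀ β

/-- The isolated points of `Γ` at which the intensity is negative. -/
def negativeIntensityPoints (Γ : Set ℝ) (A : L2R →ₗ.[ℂ] L2R) : Set ℝ :=
  {x₀ | IsIsolatedPoint Γ x₀ ∧ ∃ β : ℝ, β < 0 ∧ HasIntensity A x₀ β}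

/-- The resolvent set: `A - z` has an everywhere defined bounded inverse `R`. -/
def resolventSet (A : L2R →ₗ.[ℂ] L2R) : Set ℂ :=
  {z | ∃ R : L2R →L[ℂ] L2R,
    (∀ f : L2R, ∃ u : A.domain, (u : L2R) = R f ∧ A u - z • (u : L2R) = f) ∧
    ∀ u : A.domain, R (A u - z • (u : L2R)) = u}

/-- The spectrum of `A`. -/
def spectrumSet (A : L2R →ₗ.[ℂ] L2R) : Set ℂ := (resolventSet A)ᶜ

/-- The kernel of `A - z`, as a subspace of the domain of `A`. -/
noncomputable def eigenspace (A : L2R →ₗ.[ℂ] L2R) (z : ℂ) : Submodule ℂ A.domain :=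
  LinearMap.ker (A.toFun - z • A.domain.subtype)

/-- The negative spectrum of `A` is discrete: each of its points is an isolated point of the
spectrum and an eigenvalue of finite multiplicity. Accumulation at `0` or `-∞` is allowed. -/
def NegativeSpectrumDiscrete (A : L2R →ₗ.[ℂ] L2R) : Prop :=
  ∀ t : ℝ, t < 0 → (t : ℂ) ∈ spectrumSet A →
    ¬ AccPt (t : ℂ) (𝓟 (spectrumSet A)) ∧
    eigenspace A (t : ℂ) ≠ ⊥ ∧ FiniteDimensional ℂ (eigenspace A (t : ℂ))

/-- The number (in `ℕ∞`) of negative eigenvalues of `A`, counted with multiplicity. -/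
noncomputable def numNegativeEigenvalues (A : L2R →ₗ.[ℂ] L2R) : ℕ∞ :=
  ∑' t : Iio (0 : ℝ), Cardinal.toENat (Module.rank ℂ (eigenspace A ((t : ℝ) : ℂ)))

end DeltaPrime

/-! Each point `x k` of negative intensity `β k` yields a compactly supported trial function `F k`:
a primitive of a smooth profile `h k` plus a jump of height `β k` at `x k`, where `h k (x k) = 1`.
Compact support forces `∫ h k = -β k`. Away from `x k` the profile lives off `Γ`, so `F k` is
locally constant near the other points of `Γ`.

`jumpAt_mem_graph` puts `F k` in the domain with `A (F k) = -(h k)'`. Since `A` is self-adjoint, it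
is enough to test against each `u` of the domain. Cutting a small neighbourhood of `x k` out of `F
k` leaves a cutting function, on which `A` is minus the second derivative, and the boundary terms at
`x k` cancel in the limit because `u` and `F k` satisfy the same jump condition.

The distributional derivative of `F j` is `h j` plus `β j` times the Dirac mass at `x j`, so `⟪F j,
A (F k)⟫ = ∫ h j * h k + β j * h k (x j)`. Disjoint supports of the profiles (those of the `F k` may
overlap) make this matrix diagonal. A narrow bump at `x k` and a wide low bump far from `Γ` make `∫
h k ^ 2 < -β k`, so the diagonal is negative. The variational principle `le_numNegativeEigenvalues`
turns `N` such functions into `N` negative eigenvalues. -/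

namespace DeltaPrime

/-! ### Positivity of a bounded self-adjoint operator off its negative eigenvectors -/

section Bounded

variable {H : Type*} [NormedAddCommGroup H] [InnerProductSpace ℂ H] [CompleteSpace H]

/-- The adjoint of `C` also commutes with `W`, so `C* C v` lies in the kernel of `W`. Then `0 = ⟪v,
C* C v⟫ = ‖C v‖ ^ 2`. -/
theorem apply_eq_zero_of_orthogonal_ker {W C : H →L[ℂ] H} (hW : IsSelfAdjoint W)
    (hC : Commute C W) {v : H} (hv : ∀ k, W k = 0 → inner ℂ v k = 0) (h : W (C v) = 0) :
    C v = 0 := by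
  have hC' : Commute (star C) W := by
    have := commute_star_star.2 hC
    rwa [hW.star_eq] at this
  have hk : W (star C (C v)) = 0 := by
    have := congrArg (fun T : H →L[ℂ] H => T (C v)) hC'.eq
    simp only [mul_apply_eq_comp] at this
    rw [← this, h, map_zero]
  have := hv _ hk
  rw [ContinuousLinearMap.star_eq_adjoint, ContinuousLinearMap.adjoint_inner_right] at this
  exact inner_self_eq_zero.1 this

/-- The factors `R - μ` are stripped off one at a time: each is self-adjoint, commutes with `f(R)`,
and has a kernel orthogonal to `v`. This replaces spectral projections. -/
theorem cfc_apply_eq_zero_of_orthogonal_ker {R : H →L[ℂ] H} (hR : IsSelfAdjoint R) {v : H}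
    (s : Finset ℝ) (hv : ∀ μ ∈ s, ∀ k, R k = (μ : ℂ) • k → inner ℂ v k = 0) (f : ℝ → ℝ)
    (hf : Continuous f) (h0 : ∀ x ∈ spectrum ℝ R, (∏ μ ∈ s, (x - μ)) * f x = 0) :
    cfc f R v = 0 := by
  induction s using Finset.induction_on generalizing f with
  | empty =>
    have : cfc f R = cfc (fun _ => (0 : ℝ)) R := cfc_congr fun x hx => by simpa using h0 x hx
    rw [this]
    simp
  | insert a s ha ih =>
    have hW : cfc (fun x : ℝ => x - a) R = R - algebraMap ℝ _ a := by
      rw [cfc_sub (fun x : ℝ => x) (fun _ => a) R, cfc_id' ℝ R, cfc_const a R]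
    have h1 : cfc (fun x => (x - a) * f x) R v = 0 := by
      refine ih (fun μ hμ => hv μ (Finset.mem_insert_of_mem hμ)) _ (by fun_prop) fun x hx => ?_
      have := h0 x hx
      rw [Finset.prod_insert ha] at this
      linear_combination this
    rw [cfc_mul (fun x : ℝ => x - a) f R] at h1
    refine apply_eq_zero_of_orthogonal_ker (W := cfc (fun x : ℝ => x - a) R) (cfc_predicate _ R)
      (cfc_commute_cfc _ _ R) (fun k hk => ?_) h1
    refine hv a (Finset.mem_insert_self _ _) k ?_
    rw [hW] at hk
    have : R k - (algebraMap ℝ (H →L[ℂ] H) a) k = 0 := hk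
    rw [sub_eq_zero.1 this, Algebra.algebraMap_eq_smul_one]
    simp

/-- Split `R` into positive and negative parts. The product of the `x - μ` kills the negative part
on the spectrum, so the previous lemma shows that the negative part annihilates `v`. -/
theorem re_inner_nonneg_of_orthogonal_ker {R : H →L[ℂ] H} (hR : IsSelfAdjoint R) {v : H}
    (s : Finset ℝ) (hs : ∀ x ∈ spectrum ℝ R, x < 0 → x ∈ s)
    (hv : ∀ μ ∈ s, ∀ k, R k = (μ : ℂ) • k → inner ℂ v k = 0) :
    0 ≤ (inner ℂ (R v) v).re := by
  have hdec : R = cfc (fun x : ℝ => max x 0) R - cfc (fun x : ℝ => max (-x) 0) R := by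
    rw [← cfc_sub (fun x : ℝ => max x 0) (fun x : ℝ => max (-x) 0) R]
    conv_lhs => rw [← cfc_id' ℝ R]
    refine cfc_congr fun x _ => ?_
    rcases le_total x 0 with h | h
    · rw [max_eq_right h, max_eq_left (by linarith)]; ring
    · rw [max_eq_left h, max_eq_right (by linarith)]; ring
  have h0 : cfc (fun x : ℝ => max (-x) 0) R v = 0 := by
    refine cfc_apply_eq_zero_of_orthogonal_ker hR s hv _ (by fun_prop) fun x hx => ?_
    rcases lt_or_ge x 0 with h | h
    · rw [Finset.prod_eq_zero (hs x hx h) (sub_self x), zero_mul]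
    · rw [max_eq_right (by linarith), mul_zero]
  have hpos : 0 ≤ cfc (fun x : ℝ => max x 0) R := cfc_nonneg fun x _ => le_max_right _ _
  have := ((ContinuousLinearMap.nonneg_iff_isPositive _).1 hpos).re_inner_nonneg_left v
  rw [hdec, sub_apply, h0, sub_zero]
  exact this

end Bounded

/-! ### The unbounded operator: resolvents and the variational principle -/

theorem inner_apply_eq_of_isSelfAdjoint {A : L2R →ₗ.[ℂ] L2R} (hA : IsSelfAdjoint A)
    (u v : A.domain) : inner ℂ (A u) (v : L2R) = inner ℂ (u : L2R) (A v) := by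
  have h := LinearPMap.adjoint_isFormalAdjoint hA.dense_domain
  rw [LinearPMap.isSelfAdjoint_def.1 hA] at h
  exact h u v

theorem mem_graph_of_inner_eq {A : L2R →ₗ.[ℂ] L2R} (hA : IsSelfAdjoint A) {g w : L2R}
    (h : ∀ u : A.domain, inner ℂ w (u : L2R) = inner ℂ g (A u)) : (g, w) ∈ A.graph := by
  have h1 := LinearPMap.mem_adjoint_domain_of_exists g ⟨w, h⟩
  have h2 := LinearPMap.adjoint_apply_eq hA.dense_domain ⟨g, h1⟩ h
  have h3 : (g, w) ∈ A.adjoint.graph := (LinearPMap.mem_graph_iff _).2 ⟨⟨g, h1⟩, rfl, h2⟩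
  rwa [LinearPMap.isSelfAdjoint_def.1 hA] at h3

theorem mem_eigenspace_iff {A : L2R →ₗ.[ℂ] L2R} {z : ℂ} {u : A.domain} :
    u ∈ eigenspace A z ↔ A u = z • (u : L2R) := by
  rw [eigenspace, LinearMap.mem_ker, LinearMap.sub_apply, sub_eq_zero]
  rfl

/-- The spectral mapping property of the resolvent at `-c`, for negative real numbers. -/
theorem not_mem_spectrum_resolvent {A : L2R →ₗ.[ℂ] L2R} {c μ : ℝ} (hμ : μ ≠ 0)
    {R : L2R →L[ℂ] L2R}
    (hR1 : ∀ f : L2R, ∃ u : A.domain, (u : L2R) = R f ∧ A u - ((-c : ℝ) : ℂ) • (u : L2R) = f)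
    (hR2 : ∀ u : A.domain, R (A u - ((-c : ℝ) : ℂ) • (u : L2R)) = u)
    (hl : ((μ⁻¹ - c : ℝ) : ℂ) ∈ resolventSet A) : μ ∉ spectrum ℝ R := by
  obtain ⟨S, hS1, hS2⟩ := hl
  have hμ' : (μ : ℂ) ≠ 0 := by exact_mod_cast hμ
  rw [spectrum.notMem_iff, IsUnit.sub_iff, ContinuousLinearMap.isUnit_iff_bijective]
  have hap : ∀ v, (R - algebraMap ℝ (L2R →L[ℂ] L2R) μ) v = R v - (μ : ℂ) • v := by
    intro v
    rw [sub_apply, Algebra.algebraMap_eq_smul_one]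
    simp
    rfl
  constructor
  · rw [injective_iff_map_eq_zero]
    intro v hv
    rw [hap, sub_eq_zero] at hv
    obtain ⟨u, hu, hAu⟩ := hR1 v
    have hvu : v = (μ : ℂ)⁻¹ • (u : L2R) := by
      rw [hu, hv, smul_smul, inv_mul_cancel₀ hμ', one_smul]
    have : A u - ((μ⁻¹ - c : ℝ) : ℂ) • (u : L2R) = 0 := by
      have h1 : A u = v + ((-c : ℝ) : ℂ) • (u : L2R) := by rw [← hAu]; abel
      rw [h1, hvu]
      push_cast
      module
    have h2 := hS2 u
    rw [this, map_zero] at h2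
    rw [hvu, ← h2, smul_zero]
  · intro w
    obtain ⟨u, hu, hAu⟩ := hS1 w
    -- With `S` the resolvent at `λ = μ⁻¹ - c`, this is the identity `(R - μ)⁻¹ = -μ⁻¹ (1 + μ⁻¹ S)`.
    refine ⟨-(μ : ℂ)⁻¹ • (w + (μ : ℂ)⁻¹ • (u : L2R)), ?_⟩
    have h1 : A u - ((-c : ℝ) : ℂ) • (u : L2R) = w + (μ : ℂ)⁻¹ • (u : L2R) := by
      rw [← hAu]
      push_cast
      module
    rw [hap, map_smul, ← h1, hR2, h1, smul_smul, mul_neg, mul_inv_cancel₀ hμ']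
    module

/-- For `-c` in the resolvent set, the resolvent `R` at `-c` is bounded and self-adjoint, and its
negative spectrum lies among the numbers `(t + c)⁻¹`. Positivity of `R` at `v = (A + c) u` reads
`⟪u, (A + c) u⟫ ≥ 0`; then `c` is made small. -/
theorem re_inner_nonneg_of_orthogonal_eigenspace {A : L2R →ₗ.[ℂ] L2R} (hA : IsSelfAdjoint A)
    {s : Finset ℝ} (hs : ∀ t : ℝ, t < 0 → (t : ℂ) ∈ spectrumSet A → t ∈ s) {u : A.domain}
    (hu : ∀ t ∈ s, t < 0 → ∀ e ∈ eigenspace A (t : ℂ), inner ℂ (u : L2R) (e : L2R) = 0) :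
    0 ≤ (inner ℂ (u : L2R) (A u)).re := by
  have key : ∀ c : ℝ, 0 < c → -c ∉ s →
      0 ≤ (inner ℂ (u : L2R) (A u)).re + c * ‖(u : L2R)‖ ^ 2 := by
    intro c hc hcs
    have hres : ((-c : ℝ) : ℂ) ∈ resolventSet A := by
      by_contra h
      exact hcs (hs _ (by linarith) h)
    obtain ⟨R, hR1, hR2⟩ := hres
    have hRsa : IsSelfAdjoint R := by
      rw [ContinuousLinearMap.isSelfAdjoint_iff_isSymmetric]
      intro f g
      obtain ⟨a, ha, ha'⟩ := hR1 f
      obtain ⟨b, hb, hb'⟩ := hR1 g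
      change inner ℂ (R f) g = inner ℂ f (R g)
      rw [← ha, ← hb, ← ha', ← hb', inner_sub_left, inner_sub_right, inner_smul_left,
        inner_smul_right, inner_apply_eq_of_isSelfAdjoint hA, Complex.conj_ofReal]
    have h := re_inner_nonneg_of_orthogonal_ker hRsa
      (v := A u - ((-c : ℝ) : ℂ) • (u : L2R))
      ((s.image fun t => (t + c)⁻¹).filter (· < 0)) ?_ ?_
    · rw [hR2, inner_sub_right, inner_smul_right, inner_self_eq_norm_sq_to_K] at h
      have e : (((-c : ℝ) : ℂ) * ((‖(u : L2R)‖ : ℝ) : ℂ) ^ 2).re = -c * ‖(u : L2R)‖ ^ 2 := by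
        rw [← Complex.ofReal_pow, ← Complex.ofReal_mul, Complex.ofReal_re]
      have h' : 0 ≤ (inner ℂ (u : L2R) (A u)).re
          - (((-c : ℝ) : ℂ) * ((‖(u : L2R)‖ : ℝ) : ℂ) ^ 2).re := h
      rw [e] at h'
      linarith
    · intro x hx hx0
      rw [Finset.mem_filter, Finset.mem_image]
      refine ⟨⟨x⁻¹ - c, hs _ ?_ ?_, by simp⟩, hx0⟩
      · have := inv_lt_zero.2 hx0
        linarith
      · by_contra h
        exact not_mem_spectrum_resolvent hx0.ne hR1 hR2 (not_not.1 h) hx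
    · intro μ hμ k hk
      rw [Finset.mem_filter, Finset.mem_image] at hμ
      obtain ⟨⟨t, ht, rfl⟩, hneg⟩ := hμ
      have htc : t + c < 0 := inv_lt_zero.1 hneg
      have htc' : ((t + c : ℝ) : ℂ) ≠ 0 := by exact_mod_cast htc.ne
      obtain ⟨e, he, he'⟩ := hR1 k
      have hk' : k = ((t + c : ℝ) : ℂ) • (e : L2R) := by
        rw [he, hk, smul_smul, ← Complex.ofReal_mul, mul_inv_cancel₀ htc.ne, Complex.ofReal_one,
          one_smul]
      have hAe : A e = (t : ℂ) • (e : L2R) := by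
        have h1 : A e = k + ((-c : ℝ) : ℂ) • (e : L2R) := by rw [← he']; abel
        rw [h1, hk']
        push_cast
        module
      have h0 := hu t ht (by linarith) e (mem_eigenspace_iff.2 hAe)
      rw [hk', inner_smul_right, inner_sub_left, inner_apply_eq_of_isSelfAdjoint hA, hAe,
        inner_smul_left, inner_smul_right, h0]
      simp
  by_contra hneg
  push Not at hneg
  set q := (inner ℂ (u : L2R) (A u)).re
  -- If the form value `q` were negative, a `c` below this bound would give `q + c ‖u‖ ^ 2 < 0`.
  -- Only finitely many values of `c` are excluded.
  have hinf : (Ioo 0 (-q / (‖(u : L2R)‖ ^ 2 + 1)) \ (s.image fun t => -t : Finset ℝ)).Nonempty :=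
    ((Ioo_infinite (by have : 0 < -q := by linarith
                       positivity)).sdiff (Finset.finite_toSet _)).nonempty
  obtain ⟨c, ⟨hc0, hc1⟩, hc2⟩ := hinf
  have := key c hc0 fun h => hc2 (by
    simp only [Finset.coe_image, Set.mem_image, SetLike.mem_coe]
    exact ⟨-c, h, neg_neg c⟩)
  rw [lt_div_iff₀ (by positivity)] at hc1
  nlinarith

theorem hasSum_enat {ι : Type*} (f : ι → ℕ∞) : HasSum f (⨆ s : Finset ι, ∑ i ∈ s, f i) :=
  hasSum_of_isLUB _ (isLUB_iSup)

set_option maxHeartbeats 1000000 in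
theorem le_numNegativeEigenvalues {A : L2R →ₗ.[ℂ] L2R} (hA : IsSelfAdjoint A)
    (hd : NegativeSpectrumDiscrete A) {N : ℕ} (f : Fin N → A.domain)
    (horth : ∀ j k, j ≠ k → inner ℂ (f j : L2R) (A (f k)) = 0)
    (hneg : ∀ k, (inner ℂ (f k : L2R) (A (f k))).re < 0) :
    (N : ℕ∞) ≤ numNegativeEigenvalues A := by
  by_contra hlt
  push Not at hlt
  have hsum : ∀ s : Finset (Iio (0 : ℝ)),
      ∑ t ∈ s, Cardinal.toENat (Module.rank ℂ (eigenspace A ((t : ℝ) : ℂ))) < N := fun s =>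
    lt_of_le_of_lt ((hasSum_enat _).summable.sum_le_tsum s fun _ _ => zero_le) hlt
  have hfd : ∀ t : Iio (0 : ℝ), FiniteDimensional ℂ (eigenspace A ((t : ℝ) : ℂ)) := by
    intro t
    have := hsum {t}
    rw [Finset.sum_singleton] at this
    rw [FiniteDimensional, ← Module.rank_lt_aleph0_iff, ← Cardinal.toENat_lt_top]
    exact this.trans (ENat.natCast_lt_top N)
  have hrank : ∀ t : Iio (0 : ℝ), Cardinal.toENat (Module.rank ℂ (eigenspace A ((t : ℝ) : ℂ))) =
      (Module.finrank ℂ (eigenspace A ((t : ℝ) : ℂ)) : ℕ∞) := by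
    intro t
    have := hfd t
    rw [← Module.finrank_eq_rank, Cardinal.toENat_nat]
  -- Each nonzero eigenspace contributes at least `1`, so `N` of them would already contradict
  -- `hsum`.
  have hfin : {t : Iio (0 : ℝ) | eigenspace A ((t : ℝ) : ℂ) ≠ ⊥}.Finite := by
    by_contra hinf
    obtain ⟨s, hs, hcard⟩ := Set.Infinite.exists_subset_card_eq hinf N
    refine (hsum s).not_ge ?_
    have : ∑ t ∈ s, (1 : ℕ∞) = N := by simp [hcard]
    rw [← this]
    refine Finset.sum_le_sum fun t ht => ?_
    have := hfd t
    rw [hrank]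
    have h1 := Submodule.one_le_finrank_iff.2 (hs ht)
    exact_mod_cast h1
  set s := hfin.toFinset with hs
  have hfin_s : ∀ t : s, FiniteDimensional ℂ (eigenspace A (((t : Iio (0 : ℝ)) : ℝ) : ℂ)) :=
    fun t => hfd t
  let E : s → Submodule ℂ L2R := fun t =>
    (eigenspace A (((t : Iio (0 : ℝ)) : ℝ) : ℂ)).map A.domain.subtype
  have hE : ∀ t, FiniteDimensional ℂ (E t) := fun t => inferInstance
  -- Counting dimensions on coefficient vectors rather than on the span of the `f k` avoids a
  -- separate proof of linear independence.
  let u : (Fin N → ℂ) →ₗ[ℂ] A.domain := Fintype.linearCombination ℂ f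
  let P : (Fin N → ℂ) →ₗ[ℂ] ((t : s) → E t) := LinearMap.pi fun t =>
    (E t).orthogonalProjectionOnto.toLinearMap ∘ₗ A.domain.subtype ∘ₗ u
  have hker : LinearMap.ker P ≠ ⊥ := by
    apply LinearMap.ker_ne_bot_of_finrank_lt
    rw [Module.finrank_pi_fintype, Module.finrank_fin_fun]
    have h1 := hsum s
    simp only [hrank] at h1
    rw [← Finset.sum_coe_sort] at h1
    have h2 : ∑ t : s, Module.finrank ℂ (eigenspace A (((t : Iio (0 : ℝ)) : ℝ) : ℂ)) < N := by
      exact_mod_cast h1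
    refine lt_of_le_of_lt (Finset.sum_le_sum fun t _ => ?_) h2
    exact Submodule.finrank_map_le _ _
  obtain ⟨a, ha, ha0⟩ := Submodule.exists_mem_ne_zero_of_ne_bot hker
  have horthE : ∀ t : s, ∀ e ∈ E t, inner ℂ (u a : L2R) e = 0 := by
    intro t e he
    have h1 : (E t).orthogonalProjectionOnto (u a : L2R) = 0 := congrFun (LinearMap.mem_ker.1 ha) t
    exact Submodule.inner_left_of_mem_orthogonal he
      (Submodule.orthogonalProjectionOnto_eq_zero_iff.1 h1)
  have hnonneg := re_inner_nonneg_of_orthogonal_eigenspace hA (u := u a)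
    (s := s.image (Subtype.val : Iio (0 : ℝ) → ℝ)) ?_ ?_
  · have hua : u a = ∑ k, a k • f k := Fintype.linearCombination_apply ℂ f a
    have hval : inner ℂ (u a : L2R) (A (u a)) =
        ∑ k, ((‖a k‖ ^ 2 : ℝ) : ℂ) * inner ℂ (f k : L2R) (A (f k)) := by
      have h1 : (u a : L2R) = ∑ k, a k • (f k : L2R) := by rw [hua]; simp
      have h2 : A (u a) = ∑ k, a k • A (f k) := by
        rw [hua]
        change A.toFun _ = _
        rw [map_sum]
        exact Finset.sum_congr rfl fun k _ => map_smul A.toFun _ _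
      rw [h1, h2, sum_inner]
      refine Finset.sum_congr rfl fun j _ => ?_
      rw [inner_sum, Finset.sum_eq_single j]
      · rw [inner_smul_left, inner_smul_right, ← mul_assoc, RCLike.conj_mul]
        push_cast
        rfl
      · intro k _ hk
        rw [inner_smul_left, inner_smul_right, horth j k hk.symm]
        simp
      · simp
    rw [hval, Complex.re_sum] at hnonneg
    refine hnonneg.not_gt ?_
    obtain ⟨k, hk⟩ := Function.ne_iff.1 ha0
    refine Finset.sum_neg' (fun i _ => ?_) ⟨k, Finset.mem_univ _, ?_⟩
    · rw [Complex.re_ofReal_mul]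
      exact mul_nonpos_of_nonneg_of_nonpos (by positivity) (hneg i).le
    · rw [Complex.re_ofReal_mul]
      have : 0 < ‖a k‖ := norm_pos_iff.2 hk
      exact mul_neg_of_pos_of_neg (by positivity) (hneg k)
  -- Discreteness enters here: every negative point of the spectrum is an eigenvalue, hence belongs
  -- to the finite set `s`.
  · intro t ht htσ
    rw [Finset.mem_image]
    exact ⟨⟨t, ht⟩, hfin.mem_toFinset.2 (hd t ht htσ).2.1, rfl⟩
  · intro t ht _ e he
    obtain ⟨t', ht', rfl⟩ := Finset.mem_image.1 ht
    exact horthE ⟨t', ht'⟩ _ (Submodule.mem_map_of_mem he)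

/-! ### Pairings with real functions, and the action of `A` on cutting functions -/

theorem inner_eq_integral_of_ae_eq {w : L2R} (u : L2R) {G : ℝ → ℝ}
    (hw : (w : ℝ → ℂ) =ᵐ[volume] fun x => (G x : ℂ)) :
    inner ℂ w u = ∫ x, (G x : ℂ) * u x := by
  rw [L2.inner_def]
  refine integral_congr_ae ?_
  filter_upwards [hw] with x hx
  rw [hx, RCLike.inner_apply, Complex.conj_ofReal, mul_comm]

theorem integrable_mul_of_ae_eq {w : L2R} (u : L2R) {G : ℝ → ℝ}
    (hw : (w : ℝ → ℂ) =ᵐ[volume] fun x => (G x : ℂ)) :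
    Integrable fun x => (G x : ℂ) * u x := by
  refine (L2.integrable_inner (𝕜 := ℂ) w u).congr ?_
  filter_upwards [hw] with x hx
  rw [hx, RCLike.inner_apply, Complex.conj_ofReal, mul_comm]

theorem exists_ae_eq_of_hasCompactSupport {G : ℝ → ℝ} (hG : Continuous G)
    (hs : HasCompactSupport G) : ∃ w : L2R, (w : ℝ → ℂ) =ᵐ[volume] fun x => (G x : ℂ) := by
  have h : MemLp (fun x => (G x : ℂ)) 2 volume :=
    (Complex.continuous_ofReal.comp hG).memLp_of_hasCompactSupport
      (hs.comp_left (g := fun t : ℝ => (t : ℂ)) Complex.ofReal_zero)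
  exact ⟨h.toLp, h.coeFn_toLp⟩

theorem deriv_ofReal_comp {G : ℝ → ℝ} (hG : Differentiable ℝ G) :
    (deriv fun x => (G x : ℂ)) = fun x => ((deriv G x : ℝ) : ℂ) :=
  funext fun x => (hG x).hasDerivAt.ofReal_comp.deriv

theorem tsupport_ofReal_comp (G : ℝ → ℝ) : (tsupport fun x => (G x : ℂ)) = tsupport G := by
  rw [tsupport, tsupport]
  congr 1
  ext x
  simp

theorem isTestFunction_ofReal {U : Set ℝ} {G : ℝ → ℝ} (hG : ContDiff ℝ ∞ G)
    (hs : HasCompactSupport G) (hU : tsupport G ⊆ U) : IsTestFunction U fun x => (G x : ℂ) :=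
  ⟨Complex.ofRealCLM.contDiff.comp hG,
    hs.comp_left (g := fun t : ℝ => (t : ℂ)) Complex.ofReal_zero,
    by rwa [tsupport_ofReal_comp]⟩

theorem _root_.ContDiff.deriv_infty {G : ℝ → ℝ} (hG : ContDiff ℝ ∞ G) : ContDiff ℝ ∞ (deriv G) :=
  (contDiff_infty_iff_deriv.1 hG).2

theorem integral_mul_deriv_eq_neg {G₁ G₂ : ℝ → ℝ} (h₁ : ContDiff ℝ ∞ G₁) (h₂ : ContDiff ℝ ∞ G₂)
    (hs : HasCompactSupport G₂) : ∫ x, G₁ x * deriv G₂ x = -∫ x, deriv G₁ x * G₂ x := by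
  refine integral_mul_deriv_eq_deriv_mul_of_integrable
    (fun x _ => (h₁.differentiable (by simp) x).hasDerivAt)
    (fun x _ => (h₂.differentiable (by simp) x).hasDerivAt) ?_ ?_ ?_
  · exact (h₁.continuous.mul h₂.deriv_infty.continuous).integrable_of_hasCompactSupport
      hs.deriv.mul_left
  · exact (h₁.deriv_infty.continuous.mul h₂.continuous).integrable_of_hasCompactSupport
      hs.mul_left
  · exact (h₁.continuous.mul h₂.continuous).integrable_of_hasCompactSupport hs.mul_left

theorem integral_mul_deriv_deriv_comm {G₁ G₂ : ℝ → ℝ} (h₁ : ContDiff ℝ ∞ G₁)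
    (h₂ : ContDiff ℝ ∞ G₂) (hs₁ : HasCompactSupport G₁) (hs₂ : HasCompactSupport G₂) :
    ∫ x, G₁ x * deriv (deriv G₂) x = ∫ x, G₂ x * deriv (deriv G₁) x := by
  rw [integral_mul_deriv_eq_neg h₁ h₂.deriv_infty hs₂.deriv,
    integral_mul_deriv_eq_neg h₂ h₁.deriv_infty hs₁.deriv]
  simp only [mul_comm]

theorem apply_eq_of_mem_graph {A : L2R →ₗ.[ℂ] L2R} {w v : L2R} (h : (w, v) ∈ A.graph) :
    ∃ y : A.domain, (y : L2R) = w ∧ A y = v := (LinearPMap.mem_graph_iff _).1 h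

/-- On a cutting function `A` acts as `χ ↦ -χ''`. -/
theorem IsDeltaPrimeInteraction.cutoff_mem_graph {Γ : Set ℝ} (hclosed : IsClosed Γ)
    (hnull : volume Γ = 0) {A : L2R →ₗ.[ℂ] L2R} (hA : IsDeltaPrimeInteraction Γ A) {χ : ℝ → ℝ}
    (hχ : ContDiff ℝ ∞ χ) (hs : HasCompactSupport χ) (hΓ : tsupport (deriv χ) ⊆ Γᶜ) {w v : L2R}
    (hw : (w : ℝ → ℂ) =ᵐ[volume] fun x => (χ x : ℂ))
    (hv : (v : ℝ → ℂ) =ᵐ[volume] fun x => ((-deriv (deriv χ) x : ℝ) : ℂ)) :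
    (w, v) ∈ A.graph := by
  have hdiff := hχ.differentiable (by simp)
  have hcut : IsCutoff Γ fun x => (χ x : ℂ) := by
    refine ⟨isTestFunction_ofReal hχ hs (subset_univ _), ?_⟩
    rw [deriv_ofReal_comp hdiff]
    exact isTestFunction_ofReal hχ.deriv_infty hs.deriv hΓ
  have hmem := hA.cutoff_mem _ hcut w hw
  refine (LinearPMap.mem_graph_iff _).2 ⟨⟨w, hmem⟩, rfl, ?_⟩
  -- Pairing with `φ` supported off `Γ` moves `A` onto `φ`, where it is `-φ''`. Two integrations by
  -- parts then identify `A χ` with `-χ''` off the null set `Γ`.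
  have hcongr := IsOpen.ae_eq_zero_of_integral_contDiff_smul_eq_zero (μ := volume)
    (f := fun x => (A ⟨w, hmem⟩ : L2R) x - v x) hclosed.isOpen_compl ?_ ?_
  · refine Lp.ext ?_
    have hΓ0 : ∀ᵐ x ∂(volume : Measure ℝ), x ∉ Γ := measure_eq_zero_iff_ae_notMem.1 hnull
    filter_upwards [hcongr, hΓ0] with x hx hx'
    exact sub_eq_zero.1 (hx hx')
  · exact (((Lp.memLp _).sub (Lp.memLp _)).locallyIntegrable (by norm_num)).locallyIntegrableOn _
  · intro φ hφ hφs hφΓ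
    obtain ⟨p, hp⟩ := exists_ae_eq_of_hasCompactSupport hφ.continuous hφs
    obtain ⟨q, hq⟩ := exists_ae_eq_of_hasCompactSupport (G := fun x => -deriv (deriv φ) x)
      hφ.deriv_infty.deriv_infty.continuous.neg hφs.deriv.deriv.neg
    have hpq : (p, q) ∈ A.graph := by
      refine hA.extendsMinimal _ (isTestFunction_ofReal hφ hφs hφΓ) p q hp (hq.trans ?_)
      rw [deriv_ofReal_comp (hφ.differentiable (by simp)),
        deriv_ofReal_comp (hφ.deriv_infty.differentiable (by simp))]
      simp
    obtain ⟨y, hy, hAy⟩ := apply_eq_of_mem_graph hpq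
    have h1 := inner_apply_eq_of_isSelfAdjoint hA.selfAdjoint y ⟨w, hmem⟩
    rw [hAy, hy, inner_eq_integral_of_ae_eq _ hq, inner_eq_integral_of_ae_eq _ hp] at h1
    have h2 : ∫ x, ((-deriv (deriv φ) x : ℝ) : ℂ) * w x = ∫ x, (φ x : ℂ) * v x := by
      have e1 : ∫ x, ((-deriv (deriv φ) x : ℝ) : ℂ) * w x
          = ∫ x, ((-(χ x * deriv (deriv φ) x) : ℝ) : ℂ) := by
        refine integral_congr_ae ?_
        filter_upwards [hw] with x hx
        rw [hx]; push_cast; ring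
      have e2 : ∫ x, (φ x : ℂ) * v x = ∫ x, ((-(φ x * deriv (deriv χ) x) : ℝ) : ℂ) := by
        refine integral_congr_ae ?_
        filter_upwards [hv] with x hx
        rw [hx]; push_cast; ring
      rw [e1, e2, integral_complex_ofReal, integral_complex_ofReal, integral_neg, integral_neg,
        integral_mul_deriv_deriv_comm hχ hφ hs hφs]
    rw [h2] at h1
    have h3 : ∀ x, φ x • ((A ⟨w, hmem⟩ : L2R) x - v x) =
        (φ x : ℂ) * (A ⟨w, hmem⟩ : L2R) x - (φ x : ℂ) * v x := by
      intro x
      rw [Complex.real_smul, mul_sub]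
    simp only [h3]
    rw [integral_sub (integrable_mul_of_ae_eq _ hp) (integrable_mul_of_ae_eq _ hp), h1, sub_self]

/-! ### Excising a neighbourhood of a point -/

/-- A smooth function that vanishes near `x₀` and equals `1` at distance at least `δ` from `x₀`,
with a derivative bounded in `L₁` by `K`. -/
structure IsExcision (x₀ K δ : ℝ) (η : ℝ → ℝ) : Prop where
  smooth : ContDiff ℝ ∞ η
  eq_zero : ∀ x, |x - x₀| ≤ δ / 2 → η x = 0
  eq_one : ∀ x, δ ≤ |x - x₀| → η x = 1
  mem_Icc : ∀ x, η x ∈ Icc (0 : ℝ) 1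
  hasCompactSupport_deriv : HasCompactSupport (deriv η)
  integral_deriv : ∫ x, deriv η x = 0
  integral_abs_deriv_le : ∫ x, |deriv η x| ≤ K

/-- Rescaling one fixed bump preserves the `L₁` norm of its derivative, so a single `K` serves every
`δ`. -/
theorem exists_isExcision (x₀ : ℝ) :
    ∃ K : ℝ, ∀ δ : ℝ, 0 < δ → ∃ η : ℝ → ℝ, IsExcision x₀ K δ η := by
  let ψ : ContDiffBump (0 : ℝ) := ⟨1, 2, one_pos, one_lt_two⟩
  have hψ : ContDiff ℝ ∞ ψ := ψ.contDiff
  refine ⟨∫ x, |deriv ψ x|, fun δ hδ => ?_⟩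
  have hη : ContDiff ℝ ∞ fun x => 1 - ψ (2 / δ * (x - x₀)) := by fun_prop
  have habs : ∀ x, |2 / δ * (x - x₀)| = 2 / δ * |x - x₀| := fun x => by
    rw [abs_mul, abs_of_pos (by positivity : 0 < 2 / δ)]
  have h0 : ∀ x, δ ≤ |x - x₀| → ψ (2 / δ * (x - x₀)) = 0 := by
    intro x hx
    refine ψ.zero_of_le_dist ?_
    rw [Real.dist_eq, sub_zero, habs]
    change 2 ≤ _
    rw [div_mul_eq_mul_div, le_div_iff₀ hδ]
    linarith
  have hd : ∀ x, deriv (fun x => 1 - ψ (2 / δ * (x - x₀))) x =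
      -(2 / δ * deriv ψ (2 / δ * (x - x₀))) := by
    intro x
    have h1 : HasDerivAt (fun x => 2 / δ * (x - x₀)) (2 / δ) x := by
      simpa using ((hasDerivAt_id x).sub_const x₀).const_mul (2 / δ)
    have h2 := (hψ.differentiable (by simp) (2 / δ * (x - x₀))).hasDerivAt
    have h3 := (h2.comp x h1).const_sub 1
    rw [mul_comm (2 / δ) (deriv _ _)]
    exact h3.deriv
  have hcs : HasCompactSupport fun x => ψ (2 / δ * (x - x₀)) := by
    refine HasCompactSupport.intro (isCompact_closedBall x₀ δ) fun x hx => h0 x ?_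
    rw [Metric.mem_closedBall, Real.dist_eq] at hx
    linarith
  have hcs' : HasCompactSupport (deriv fun x => 1 - ψ (2 / δ * (x - x₀))) := by
    have e : (deriv fun x => 1 - ψ (2 / δ * (x - x₀))) =
        -deriv (fun x => ψ (2 / δ * (x - x₀))) := by
      funext x
      rw [deriv_const_sub]
      rfl
    rw [e]
    exact hcs.deriv.neg
  refine ⟨fun x => 1 - ψ (2 / δ * (x - x₀)), hη, fun x hx => ?_, fun x hx => ?_,
    fun x => ⟨?_, ?_⟩, hcs', ?_, ?_⟩
  · rw [ψ.one_of_mem_closedBall, sub_self]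
    rw [Metric.mem_closedBall, Real.dist_eq, sub_zero, habs]
    change _ ≤ (1 : ℝ)
    rw [div_mul_eq_mul_div, div_le_iff₀ hδ]
    linarith
  · simp only [h0 x hx, sub_zero]
  · linarith [ψ.le_one (x := 2 / δ * (x - x₀))]
  · linarith [ψ.nonneg (x := 2 / δ * (x - x₀))]
  · have hsm : ContDiff ℝ ∞ fun x => ψ (2 / δ * (x - x₀)) := by fun_prop
    have := integral_mul_deriv_eq_neg (contDiff_const (c := (1 : ℝ))) hsm hcs
    simp only [one_mul, deriv_const, zero_mul, integral_zero, neg_zero] at this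
    simp only [deriv_const_sub, integral_neg, this, neg_zero]
  · refine le_of_eq ?_
    simp only [hd, abs_neg, abs_mul, abs_of_pos (by positivity : 0 < 2 / δ)]
    rw [integral_const_mul,
      integral_sub_right_eq_self (fun x => |deriv ψ (2 / δ * x)|) x₀,
      Measure.integral_comp_mul_left (fun x => |deriv ψ x|) (2 / δ),
      abs_of_pos (by positivity), smul_eq_mul, ← mul_assoc, mul_inv_cancel₀ (by positivity),
      one_mul]

namespace IsExcision

variable {x₀ K δ : ℝ} {η : ℝ → ℝ}

theorem eventuallyEq_zero (hη : IsExcision x₀ K δ η) (hδ : 0 < δ) : η =ᶠ[𝓝 x₀] 0 := by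
  filter_upwards [Metric.ball_mem_nhds x₀ (half_pos hδ)] with x hx
  exact hη.eq_zero x (by rw [← Real.dist_eq]; exact (Metric.mem_ball.1 hx).le)

theorem eventuallyEq_one (hη : IsExcision x₀ K δ η) {x : ℝ} (hx : δ < |x - x₀|) :
    η =ᶠ[𝓝 x] fun _ => 1 := by
  have : ∀ᶠ y in 𝓝 x, δ < |y - x₀| :=
    (Continuous.tendsto (by fun_prop : Continuous fun y => |y - x₀|) x).eventually_const_lt hx
  filter_upwards [this] with y hy using hη.eq_one y hy.le

theorem deriv_support (hη : IsExcision x₀ K δ η) (hδ : 0 < δ) {x : ℝ} (hx : deriv η x ≠ 0) :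
    x ≠ x₀ ∧ |x - x₀| ≤ δ := by
  constructor
  · rintro rfl
    exact hx (by rw [(hη.eventuallyEq_zero hδ).deriv_eq]; simp)
  · by_contra h
    exact hx (by rw [(hη.eventuallyEq_one (not_le.1 h)).deriv_eq]; simp)

theorem deriv_deriv_support (hη : IsExcision x₀ K δ η) (hδ : 0 < δ) {x : ℝ}
    (hx : deriv (deriv η) x ≠ 0) : x ≠ x₀ ∧ |x - x₀| ≤ δ := by
  constructor
  · rintro rfl
    exact hx (by rw [(hη.eventuallyEq_zero hδ).deriv.deriv_eq]; simp)
  · by_contra h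
    exact hx (by rw [(hη.eventuallyEq_one (not_le.1 h)).deriv.deriv_eq]; simp)

end IsExcision

theorem integrable_mul_of_bound_on_support {b : ℝ → ℂ} {e : ℝ → ℝ} {C : ℝ}
    (hb : AEStronglyMeasurable b volume) (he : Continuous e) (hs : HasCompactSupport e)
    (hC : ∀ x, e x ≠ 0 → ‖b x‖ ≤ C) :
    Integrable (fun x => b x * e x) ∧ ‖∫ x, b x * e x‖ ≤ C * ∫ x, |e x| := by
  have hle : ∀ x, ‖b x * e x‖ ≤ C * |e x| := by
    intro x
    rw [norm_mul, Complex.norm_real, Real.norm_eq_abs]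
    by_cases h : e x = 0
    · simp [h]
    · exact mul_le_mul_of_nonneg_right (hC x h) (abs_nonneg _)
  have hi : Integrable fun x => C * |e x| :=
    (he.abs.integrable_of_hasCompactSupport hs.norm).const_mul C
  refine ⟨hi.mono' (hb.mul (Complex.continuous_ofReal.comp he).aestronglyMeasurable)
    (ae_of_all _ hle), ?_⟩
  rw [← integral_const_mul]
  exact norm_integral_le_of_norm_le hi (ae_of_all _ hle)

/-- Since `η n` has a derivative of integral zero, `l` may be subtracted from `g`. What remains is
small where that derivative lives, and the `L₁` bound `K` is uniform. A common two-sided limit is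
essential. -/
theorem tendsto_integral_mul_deriv_excision {x₀ K : ℝ} {η : ℕ → ℝ → ℝ}
    (hη : ∀ n : ℕ, IsExcision x₀ K (1 / ((n : ℝ) + 1)) (η n)) {g : ℝ → ℂ}
    (hg : AEStronglyMeasurable g volume) {l : ℂ} (hl : Tendsto g (𝓝[≠] x₀) (𝓝 l)) :
    Tendsto (fun n => ∫ x, g x * ((deriv (η n) x : ℝ) : ℂ)) atTop (𝓝 0) := by
  have hK : 0 ≤ K := (integral_nonneg fun _ => abs_nonneg _).trans (hη 0).integral_abs_deriv_le
  rw [Metric.tendsto_nhds]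
  intro ε hε
  have h1 : ∀ᶠ x in 𝓝[≠] x₀, ‖g x - l‖ ≤ ε / (K + 1) := by
    filter_upwards [Metric.tendsto_nhds.1 hl (ε / (K + 1)) (by positivity)] with x hx
    rw [← dist_eq_norm]
    exact hx.le
  obtain ⟨r, hr, hr'⟩ := Metric.mem_nhdsWithin_iff.1 h1
  filter_upwards [tendsto_one_div_add_atTop_nhds_zero_nat.eventually_lt_const hr] with n hn
  have hδ : 0 < 1 / ((n : ℝ) + 1) := by positivity
  have hc := (hη n).smooth.deriv_infty.continuous
  have hcs := (hη n).hasCompactSupport_deriv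
  have hb : ∀ x, deriv (η n) x ≠ 0 → ‖g x - l‖ ≤ ε / (K + 1) := by
    intro x hx
    obtain ⟨h2, h3⟩ := (hη n).deriv_support hδ hx
    exact hr' ⟨by rw [Metric.mem_ball, Real.dist_eq]; linarith, h2⟩
  obtain ⟨h4, h5⟩ := integrable_mul_of_bound_on_support
    (b := fun x => g x - l) (hg.sub aestronglyMeasurable_const) hc hcs hb
  have h6 : Integrable fun x => l * ((deriv (η n) x : ℝ) : ℂ) :=
    (hc.integrable_of_hasCompactSupport hcs).ofReal.const_mul l
  have h7 : ∫ x, g x * ((deriv (η n) x : ℝ) : ℂ) = ∫ x, (g x - l) * ((deriv (η n) x : ℝ) : ℂ) := by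
    have : ∀ x, g x * ((deriv (η n) x : ℝ) : ℂ) =
        (g x - l) * ((deriv (η n) x : ℝ) : ℂ) + l * ((deriv (η n) x : ℝ) : ℂ) := fun x => by ring
    simp only [this]
    rw [integral_add h4 h6, integral_const_mul, integral_complex_ofReal, (hη n).integral_deriv]
    simp
  rw [dist_zero_right, h7]
  refine h5.trans_lt ?_
  calc ε / (K + 1) * ∫ x, |deriv (η n) x| ≤ ε / (K + 1) * K :=
        mul_le_mul_of_nonneg_left (hη n).integral_abs_deriv_le (by positivity)
    _ < ε := by
        rw [div_mul_eq_mul_div, div_lt_iff₀ (by positivity)]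
        nlinarith

/-! ### Smooth functions with one jump -/

/-- The function `P` with a jump of height `κ` at `x₀`. -/
noncomputable def jumpAt (x₀ κ : ℝ) (P : ℝ → ℝ) (x : ℝ) : ℝ :=
  P x + (Ioi x₀).indicator (fun _ => κ) x

theorem jumpAt_of_lt {x₀ κ : ℝ} {P : ℝ → ℝ} {x : ℝ} (h : x₀ < x) :
    jumpAt x₀ κ P x = P x + κ := by
  rw [jumpAt, indicator_of_mem (mem_Ioi.2 h)]

theorem jumpAt_of_le {x₀ κ : ℝ} {P : ℝ → ℝ} {x : ℝ} (h : x ≤ x₀) :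
    jumpAt x₀ κ P x = P x := by
  rw [jumpAt, indicator_of_notMem (notMem_Ioi.2 h), add_zero]

theorem jumpAt_eventuallyEq {x₀ κ : ℝ} {P : ℝ → ℝ} {x : ℝ} (h : x ≠ x₀) :
    ∃ c : ℝ, jumpAt x₀ κ P =ᶠ[𝓝 x] fun y => P y + c := by
  rcases lt_or_gt_of_ne h with h | h
  · refine ⟨0, ?_⟩
    filter_upwards [Iio_mem_nhds h] with y hy
    rw [jumpAt_of_le (le_of_lt hy), add_zero]
  · refine ⟨κ, ?_⟩
    filter_upwards [Ioi_mem_nhds h] with y hy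
    rw [jumpAt_of_lt hy]

theorem hasDerivAt_jumpAt {x₀ κ : ℝ} {P : ℝ → ℝ} (hP : ContDiff ℝ ∞ P) {x : ℝ} (h : x ≠ x₀) :
    HasDerivAt (jumpAt x₀ κ P) (deriv P x) x := by
  obtain ⟨c, hc⟩ := jumpAt_eventuallyEq (κ := κ) (P := P) h
  exact ((hP.differentiable (by simp) x).hasDerivAt.add_const c).congr_of_eventuallyEq hc

theorem contDiffAt_jumpAt {x₀ κ : ℝ} {P : ℝ → ℝ} (hP : ContDiff ℝ ∞ P) {x : ℝ} (h : x ≠ x₀) :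
    ContDiffAt ℝ ∞ (jumpAt x₀ κ P) x := by
  obtain ⟨c, hc⟩ := jumpAt_eventuallyEq (κ := κ) (P := P) h
  exact (hP.contDiffAt.add contDiffAt_const).congr_of_eventuallyEq hc

section Excise

variable {x₀ κ : ℝ} {P η : ℝ → ℝ}

theorem contDiff_mul_jumpAt (hP : ContDiff ℝ ∞ P) (hη : ContDiff ℝ ∞ η) (h0 : η =ᶠ[𝓝 x₀] 0) :
    ContDiff ℝ ∞ fun x => η x * jumpAt x₀ κ P x := by
  rw [contDiff_iff_contDiffAt]
  intro x
  by_cases hx : x = x₀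
  · subst hx
    refine (contDiffAt_const (c := (0 : ℝ))).congr_of_eventuallyEq ?_
    filter_upwards [h0] with y hy
    rw [hy]; simp
  · exact hη.contDiffAt.mul (contDiffAt_jumpAt hP hx)

theorem hasDerivAt_mul_jumpAt (hP : ContDiff ℝ ∞ P) (hη : ContDiff ℝ ∞ η) (h0 : η =ᶠ[𝓝 x₀] 0)
    (x : ℝ) : HasDerivAt (fun x => η x * jumpAt x₀ κ P x)
      (deriv η x * jumpAt x₀ κ P x + η x * deriv P x) x := by
  by_cases hx : x = x₀
  · subst hx
    have h1 : deriv η x = 0 := by rw [h0.deriv_eq]; simp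
    have h2 : η x = 0 := h0.self_of_nhds
    rw [h1, h2, zero_mul, zero_mul, add_zero]
    refine (hasDerivAt_const x (0 : ℝ)).congr_of_eventuallyEq ?_
    filter_upwards [h0] with y hy
    rw [hy]; simp
  · exact (hη.differentiable (by simp) x).hasDerivAt.mul (hasDerivAt_jumpAt hP hx)

theorem deriv_mul_jumpAt (hP : ContDiff ℝ ∞ P) (hη : ContDiff ℝ ∞ η) (h0 : η =ᶠ[𝓝 x₀] 0) :
    (deriv fun x => η x * jumpAt x₀ κ P x) =
      fun x => deriv η x * jumpAt x₀ κ P x + η x * deriv P x :=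
  funext fun x => (hasDerivAt_mul_jumpAt hP hη h0 x).deriv

theorem deriv_deriv_mul_jumpAt (hP : ContDiff ℝ ∞ P) (hη : ContDiff ℝ ∞ η)
    (h0 : η =ᶠ[𝓝 x₀] 0) :
    deriv (deriv fun x => η x * jumpAt x₀ κ P x) = fun x =>
      deriv (deriv η) x * jumpAt x₀ κ P x + 2 * (deriv η x * deriv P x)
        + η x * deriv (deriv P) x := by
  rw [deriv_mul_jumpAt hP hη h0]
  funext x
  have h0' : deriv η =ᶠ[𝓝 x₀] 0 := h0.deriv.trans (by simp)
  have h1 := (hasDerivAt_mul_jumpAt (κ := κ) hP hη.deriv_infty h0' x).add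
    ((hη.differentiable (by simp) x).hasDerivAt.mul
      (hP.deriv_infty.differentiable (by simp) x).hasDerivAt)
  refine h1.deriv.trans ?_
  ring

end Excise

theorem measurable_jumpAt {x₀ κ : ℝ} {P : ℝ → ℝ} (hP : Continuous P) :
    Measurable (jumpAt x₀ κ P) :=
  hP.measurable.add (measurable_const.indicator measurableSet_Ioi)

theorem exists_ae_eq_jumpAt {x₀ κ : ℝ} {P : ℝ → ℝ} (hP : Continuous P)
    (hs : HasCompactSupport (jumpAt x₀ κ P)) :
    ∃ w : L2R, (w : ℝ → ℂ) =ᵐ[volume] fun x => (jumpAt x₀ κ P x : ℂ) := by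
  obtain ⟨C, hC⟩ := hs.isCompact.exists_bound_of_continuousOn hP.continuousOn
  have hm : MemLp (fun x => (jumpAt x₀ κ P x : ℂ)) 2 volume := by
    have hmeas : AEStronglyMeasurable (fun x => (jumpAt x₀ κ P x : ℂ)) volume :=
      (Complex.measurable_ofReal.comp (measurable_jumpAt hP)).aestronglyMeasurable
    refine (memLp_indicator_const 2 hs.isCompact.measurableSet (C + |κ|)
      (Or.inr hs.isCompact.measure_lt_top.ne)).mono hmeas (ae_of_all _ fun x => ?_)
    by_cases hx : x ∈ tsupport (jumpAt x₀ κ P)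
    · rw [indicator_of_mem hx, Complex.norm_real]
      refine le_trans ?_ (le_abs_self _)
      rw [jumpAt]
      refine (norm_add_le _ _).trans (add_le_add (hC x hx) ?_)
      refine (norm_indicator_le_norm_self _ _).trans le_rfl
    · rw [indicator_of_notMem hx, image_eq_zero_of_notMem_tsupport hx]
      simp
  exact ⟨hm.toLp, hm.coeFn_toLp⟩

/-! ### The boundary form at an interaction point and membership in the domain -/

theorem eventually_norm_le_of_tendsto_sides {g : ℝ → ℂ} {x₀ : ℝ} {a b : ℂ}
    (ha : Tendsto g (𝓝[>] x₀) (𝓝 a)) (hb : Tendsto g (𝓝[<] x₀) (𝓝 b)) :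
    ∃ C, ∀ᶠ x in 𝓝[≠] x₀, ‖g x‖ ≤ C := by
  refine ⟨max (‖a‖ + 1) (‖b‖ + 1), ?_⟩
  rw [← nhdsLT_sup_nhdsGT, eventually_sup]
  constructor
  · filter_upwards [hb.norm.eventually_lt_const (lt_add_one ‖b‖)] with x hx
    exact hx.le.trans (le_max_right _ _)
  · filter_upwards [ha.norm.eventually_lt_const (lt_add_one ‖a‖)] with x hx
    exact hx.le.trans (le_max_left _ _)

/-- The boundary form `f F' - f' F` is continuous across `x₀` when both functions satisfy the
`δ'`-condition. -/
theorem DeltaPrimeCondition.exists_tendsto {f : ℝ → ℂ} {x₀ β : ℝ}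
    (hf : DeltaPrimeCondition f x₀ β) {P : ℝ → ℝ} (hP : ContDiff ℝ ∞ P) :
    (∃ l, Tendsto (fun x => ((deriv P x : ℝ) : ℂ) * f x
      - (jumpAt x₀ (β * deriv P x₀) P x : ℂ) * deriv f x) (𝓝[≠] x₀) (𝓝 l)) ∧
    ∃ C, ∀ᶠ x in 𝓝[≠] x₀, ‖(jumpAt x₀ (β * deriv P x₀) P x : ℂ) * f x‖ ≤ C ∧
      ‖((deriv P x : ℝ) : ℂ) * f x‖ ≤ C ∧ ‖(jumpAt x₀ (β * deriv P x₀) P x : ℂ) * deriv f x‖ ≤ C := by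
  obtain ⟨a, b, c, d, ha, hb, hc, hd, hcd, hab⟩ := hf
  set κ := β * deriv P x₀ with hκ
  have hPc : Tendsto (fun x => (P x : ℂ)) (𝓝 x₀) (𝓝 (P x₀ : ℂ)) :=
    (Complex.continuous_ofReal.comp hP.continuous).tendsto x₀
  have hhc : Tendsto (fun x => ((deriv P x : ℝ) : ℂ)) (𝓝 x₀) (𝓝 ((deriv P x₀ : ℝ) : ℂ)) :=
    (Complex.continuous_ofReal.comp hP.deriv_infty.continuous).tendsto x₀
  have hFr : Tendsto (fun x => (jumpAt x₀ κ P x : ℂ)) (𝓝[>] x₀) (𝓝 ((P x₀ : ℂ) + κ)) := by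
    refine ((hPc.mono_left nhdsWithin_le_nhds).add_const (κ : ℂ)).congr' ?_
    filter_upwards [self_mem_nhdsWithin] with x hx
    rw [jumpAt_of_lt hx, Complex.ofReal_add]
  have hFl : Tendsto (fun x => (jumpAt x₀ κ P x : ℂ)) (𝓝[<] x₀) (𝓝 (P x₀ : ℂ)) := by
    refine (hPc.mono_left nhdsWithin_le_nhds).congr' ?_
    filter_upwards [self_mem_nhdsWithin] with x hx
    rw [jumpAt_of_le (le_of_lt hx)]
  have hhr := hhc.mono_left (nhdsWithin_le_nhds (s := Ioi x₀))
  have hhl := hhc.mono_left (nhdsWithin_le_nhds (s := Iio x₀))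
  constructor
  · refine ⟨((deriv P x₀ : ℝ) : ℂ) * a - ((P x₀ : ℂ) + κ) * c, ?_⟩
    rw [← nhdsLT_sup_nhdsGT, tendsto_sup]
    refine ⟨?_, (hhr.mul ha).sub (hFr.mul hc)⟩
    -- Substituting `a = b + β c` and `c = d`, the two contributions `β P'(x₀) c` cancel.
    have e : ((deriv P x₀ : ℝ) : ℂ) * a - ((P x₀ : ℂ) + κ) * c =
        ((deriv P x₀ : ℝ) : ℂ) * b - (P x₀ : ℂ) * d := by
      have h1 : a = b + (β : ℂ) * ((c + d) / 2) := by rw [← hab]; ring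
      rw [h1, hcd, hκ]
      push_cast
      ring
    rw [e]
    exact (hhl.mul hb).sub (hFl.mul hd)
  · obtain ⟨C₁, h₁⟩ := eventually_norm_le_of_tendsto_sides (hFr.mul ha) (hFl.mul hb)
    obtain ⟨C₂, h₂⟩ := eventually_norm_le_of_tendsto_sides (hhr.mul ha) (hhl.mul hb)
    obtain ⟨C₃, h₃⟩ := eventually_norm_le_of_tendsto_sides (hFr.mul hc) (hFl.mul hd)
    refine ⟨max C₁ (max C₂ C₃), ?_⟩
    filter_upwards [h₁, h₂, h₃] with x hx₁ hx₂ hx₃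
    exact ⟨hx₁.trans (le_max_left _ _), hx₂.trans ((le_max_left _ _).trans (le_max_right _ _)),
      hx₃.trans ((le_max_right _ _).trans (le_max_right _ _))⟩

theorem tendsto_integral_excision_mul {x₀ K : ℝ} {η : ℕ → ℝ → ℝ}
    (hη : ∀ n : ℕ, IsExcision x₀ K (1 / ((n : ℝ) + 1)) (η n)) {g : ℝ → ℂ} (hg : Integrable g) :
    Tendsto (fun n => ∫ x, (η n x : ℂ) * g x) atTop (𝓝 (∫ x, g x)) := by
  refine tendsto_integral_of_dominated_convergence (fun x => ‖g x‖) (fun n => ?_) hg.norm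
    (fun n => ae_of_all _ fun x => ?_) ?_
  · exact (Complex.continuous_ofReal.comp (hη n).smooth.continuous).aestronglyMeasurable.mul
      hg.aestronglyMeasurable
  · obtain ⟨h0, h1⟩ := (hη n).mem_Icc x
    rw [norm_mul, Complex.norm_real, Real.norm_eq_abs, abs_of_nonneg h0]
    exact mul_le_of_le_one_left (norm_nonneg _) h1
  · have hne : ∀ᵐ x : ℝ, x ≠ x₀ := by simp [ae_iff]
    filter_upwards [hne] with x hx
    refine tendsto_const_nhds.congr' ?_
    have hpos : 0 < |x - x₀| := abs_pos.2 (sub_ne_zero.2 hx)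
    filter_upwards [tendsto_one_div_add_atTop_nhds_zero_nat.eventually_lt_const hpos] with n hn
    rw [(hη n).eq_one x hn.le, Complex.ofReal_one, one_mul]

/-- Green's formula on the excised region. -/
theorem integral_excision_green {x₀ κ K δ r C : ℝ} {η : ℝ → ℝ} (hη : IsExcision x₀ K δ η)
    (hδ : 0 < δ) (hδr : δ < r) {P : ℝ → ℝ} (hP : ContDiff ℝ ∞ P) {f : ℝ → ℂ}
    (hf : AEStronglyMeasurable f volume)
    (hr : ∀ x, x ≠ x₀ → |x - x₀| < r → DifferentiableAt ℝ f x ∧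
      ‖(jumpAt x₀ κ P x : ℂ) * f x‖ ≤ C ∧ ‖((deriv P x : ℝ) : ℂ) * f x‖ ≤ C ∧
      ‖(jumpAt x₀ κ P x : ℂ) * deriv f x‖ ≤ C) :
    Integrable (fun x => ((deriv (deriv η) x * jumpAt x₀ κ P x
      + 2 * (deriv η x * deriv P x) : ℝ) : ℂ) * f x) ∧
    ∫ x, ((deriv (deriv η) x * jumpAt x₀ κ P x + 2 * (deriv η x * deriv P x) : ℝ) : ℂ) * f x =
      ∫ x, (((deriv P x : ℝ) : ℂ) * f x - (jumpAt x₀ κ P x : ℂ) * deriv f x)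
        * ((deriv η x : ℝ) : ℂ) := by
  have hFm : AEStronglyMeasurable (fun x => (jumpAt x₀ κ P x : ℂ)) volume :=
    (Complex.measurable_ofReal.comp (measurable_jumpAt hP.continuous)).aestronglyMeasurable
  have hhm : AEStronglyMeasurable (fun x => ((deriv P x : ℝ) : ℂ)) volume :=
    (Complex.continuous_ofReal.comp hP.deriv_infty.continuous).aestronglyMeasurable
  have hf' : AEStronglyMeasurable (deriv f) volume := (measurable_deriv f).aestronglyMeasurable
  have hc1 := hη.smooth.deriv_infty.continuous
  have hc2 := hη.smooth.deriv_infty.deriv_infty.continuous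
  have hs1 := hη.hasCompactSupport_deriv
  have hs2 := hs1.deriv
  have hb : ∀ x, deriv η x ≠ 0 → x ≠ x₀ ∧ |x - x₀| < r := fun x hx =>
    (hη.deriv_support hδ hx).imp_right fun h => h.trans_lt hδr
  have hb' : ∀ x, deriv (deriv η) x ≠ 0 → x ≠ x₀ ∧ |x - x₀| < r := fun x hx =>
    (hη.deriv_deriv_support hδ hx).imp_right fun h => h.trans_lt hδr
  have i1 := (integrable_mul_of_bound_on_support (hFm.mul hf) hc2 hs2 fun x hx =>
    (hr x (hb' x hx).1 (hb' x hx).2).2.1).1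
  have i0 := (integrable_mul_of_bound_on_support (hFm.mul hf) hc1 hs1 fun x hx =>
    (hr x (hb x hx).1 (hb x hx).2).2.1).1
  have i2 := (integrable_mul_of_bound_on_support (hhm.mul hf) hc1 hs1 fun x hx =>
    (hr x (hb x hx).1 (hb x hx).2).2.2.1).1
  have i3 := (integrable_mul_of_bound_on_support (hFm.mul hf') hc1 hs1 fun x hx =>
    (hr x (hb x hx).1 (hb x hx).2).2.2.2).1
  -- The total derivative of `F f η'`, with `F` the jump function, integrates to zero. It trades
  -- `η'' F f` for first-order terms, so no second derivative of `f` is needed. Outside the region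
  -- where `f` is controlled, `η'` vanishes locally.
  have hderiv : ∀ x, HasDerivAt
      (fun x => ((jumpAt x₀ κ P x : ℂ) * f x) * ((deriv η x : ℝ) : ℂ))
      ((((deriv P x : ℝ) : ℂ) * f x + (jumpAt x₀ κ P x : ℂ) * deriv f x) * ((deriv η x : ℝ) : ℂ)
        + ((jumpAt x₀ κ P x : ℂ) * f x) * ((deriv (deriv η) x : ℝ) : ℂ)) x := by
    intro x
    by_cases hx : x ≠ x₀ ∧ |x - x₀| < r
    · exact ((hasDerivAt_jumpAt hP hx.1).ofReal_comp.mul (hr x hx.1 hx.2).1.hasDerivAt).mul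
        (hη.smooth.deriv_infty.differentiable (by simp) x).hasDerivAt.ofReal_comp
    · have h0 : deriv η =ᶠ[𝓝 x] 0 := by
        by_cases hx₀ : x = x₀
        · subst hx₀
          exact (hη.eventuallyEq_zero hδ).deriv.trans (by simp)
        · have : r ≤ |x - x₀| := by
            by_contra h
            exact hx ⟨hx₀, not_le.1 h⟩
          exact (hη.eventuallyEq_one (hδr.trans_le this)).deriv.trans (by rw [deriv_const']; rfl)
      have h1 : deriv η x = 0 := h0.self_of_nhds
      have h2 : deriv (deriv η) x = 0 := by rw [h0.deriv_eq]; simp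
      rw [h1, h2, Complex.ofReal_zero, mul_zero, mul_zero, add_zero]
      refine (hasDerivAt_const x (0 : ℂ)).congr_of_eventuallyEq ?_
      filter_upwards [h0] with y hy
      rw [hy]
      simp
  have hi : Integrable fun x => (((deriv P x : ℝ) : ℂ) * f x + (jumpAt x₀ κ P x : ℂ) * deriv f x)
      * ((deriv η x : ℝ) : ℂ)
        + ((jumpAt x₀ κ P x : ℂ) * f x) * ((deriv (deriv η) x : ℝ) : ℂ) := by
    refine ((i2.add i3).add i1).congr (ae_of_all _ fun x => ?_)
    simp only [Pi.add_apply, Pi.mul_apply]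
    ring
  have hzero := integral_eq_zero_of_hasDerivAt_of_integrable hderiv hi i0
  have hi' : Integrable fun x => (((deriv P x : ℝ) : ℂ) * f x - (jumpAt x₀ κ P x : ℂ) * deriv f x)
      * ((deriv η x : ℝ) : ℂ) := by
    refine (i2.sub i3).congr (ae_of_all _ fun x => ?_)
    simp only [Pi.sub_apply, Pi.mul_apply]
    ring
  have hsplit : (fun x => ((deriv (deriv η) x * jumpAt x₀ κ P x
      + 2 * (deriv η x * deriv P x) : ℝ) : ℂ) * f x) =
      fun x => (((deriv P x : ℝ) : ℂ) * f x - (jumpAt x₀ κ P x : ℂ) * deriv f x)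
        * ((deriv η x : ℝ) : ℂ) +
      ((((deriv P x : ℝ) : ℂ) * f x + (jumpAt x₀ κ P x : ℂ) * deriv f x) * ((deriv η x : ℝ) : ℂ)
        + ((jumpAt x₀ κ P x : ℂ) * f x) * ((deriv (deriv η) x : ℝ) : ℂ)) := by
    funext x
    push_cast
    ring
  rw [hsplit]
  refine ⟨hi'.add hi, ?_⟩
  rw [integral_add hi' hi, hzero, add_zero]

/-- A primitive of `h`, with the jump `β h(x₀)` at `x₀` and locally constant near the other points
of `Γ`, belongs to the domain of `A`. -/
theorem IsDeltaPrimeInteraction.jumpAt_mem_graph {Γ : Set ℝ} (hclosed : IsClosed Γ)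
    (hnull : volume Γ = 0) {A : L2R →ₗ.[ℂ] L2R} (hA : IsDeltaPrimeInteraction Γ A) {x₀ β ε : ℝ}
    (hε : 0 < ε) (hiso : ∀ x ∈ Γ, |x - x₀| < ε → x = x₀) (hβ : HasIntensity A x₀ β) {P : ℝ → ℝ}
    (hP : ContDiff ℝ ∞ P) (hPs : HasCompactSupport (deriv P))
    (hs : HasCompactSupport (jumpAt x₀ (β * deriv P x₀) P))
    (hsupp : ∀ x ∈ Γ, x ∈ tsupport (deriv P) → x = x₀) {w v : L2R}
    (hw : (w : ℝ → ℂ) =ᵐ[volume] fun x => (jumpAt x₀ (β * deriv P x₀) P x : ℂ))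
    (hv : (v : ℝ → ℂ) =ᵐ[volume] fun x => ((-deriv (deriv P) x : ℝ) : ℂ)) :
    (w, v) ∈ A.graph := by
  refine mem_graph_of_inner_eq hA.selfAdjoint fun u => ?_
  obtain ⟨f, huf, hdiff, hcond⟩ := hβ u u.2
  obtain ⟨⟨l, hl⟩, C, hC⟩ := hcond.exists_tendsto hP
  set κ := β * deriv P x₀
  obtain ⟨r, hr, hr'⟩ := Metric.mem_nhdsWithin_iff.1 (hdiff.and hC)
  obtain ⟨K, hK⟩ := exists_isExcision x₀
  choose η hη using fun n : ℕ => hK (1 / ((n : ℝ) + 1)) (by positivity)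
  have hfm : AEStronglyMeasurable f volume := (Lp.aestronglyMeasurable (u : L2R)).congr huf
  have hFm : AEStronglyMeasurable (fun x => (jumpAt x₀ κ P x : ℂ)) volume :=
    (Complex.measurable_ofReal.comp (measurable_jumpAt hP.continuous)).aestronglyMeasurable
  have hhm : AEStronglyMeasurable (fun x => ((deriv P x : ℝ) : ℂ)) volume :=
    (Complex.continuous_ofReal.comp hP.deriv_infty.continuous).aestronglyMeasurable
  have hlim0 := tendsto_integral_mul_deriv_excision hη
    ((hhm.mul hfm).sub (hFm.mul (measurable_deriv f).aestronglyMeasurable)) hl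
  have hlim1 := tendsto_integral_excision_mul hη (integrable_mul_of_ae_eq (A u) hw)
  have hlim2 := tendsto_integral_excision_mul hη (integrable_mul_of_ae_eq (u : L2R) hv)
  -- This is symmetry of `A` for the pair `η n * F`, `u`, with `(η F)''` expanded and the terms
  -- containing `η'` or `η''` reduced by Green's formula.
  have hseq : ∀ᶠ n in atTop,
      -∫ x, (((deriv P x : ℝ) : ℂ) * f x - (jumpAt x₀ κ P x : ℂ) * deriv f x)
        * ((deriv (η n) x : ℝ) : ℂ) =
      (∫ x, (η n x : ℂ) * ((jumpAt x₀ κ P x : ℂ) * (A u) x))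
        - ∫ x, (η n x : ℂ) * (((-deriv (deriv P) x : ℝ) : ℂ) * (u : L2R) x) := by
    filter_upwards [tendsto_one_div_add_atTop_nhds_zero_nat.eventually_lt_const hr,
      tendsto_one_div_add_atTop_nhds_zero_nat.eventually_lt_const hε] with n hnr hnε
    have hδ : 0 < 1 / ((n : ℝ) + 1) := by positivity
    have hsm := (hη n).smooth
    have h0 := (hη n).eventuallyEq_zero hδ
    have hχ := contDiff_mul_jumpAt (κ := κ) hP hsm h0
    have hχs : HasCompactSupport fun x => η n x * jumpAt x₀ κ P x := hs.mul_left
    have hχΓ : tsupport (deriv fun x => η n x * jumpAt x₀ κ P x) ⊆ Γᶜ := by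
      intro x hx hxΓ
      refine (notMem_tsupport_iff_eventuallyEq.2 ?_) hx
      rw [deriv_mul_jumpAt hP hsm h0]
      by_cases hx₀ : x = x₀
      · subst hx₀
        filter_upwards [h0, h0.deriv] with y hy hy'
        rw [hy, hy']
        simp
      · have h1 : 1 / ((n : ℝ) + 1) < |x - x₀| := by
          refine hnε.trans_le (not_lt.1 fun h => hx₀ (hiso x hxΓ h))
        have h2 := notMem_tsupport_iff_eventuallyEq.1 fun h => hx₀ (hsupp x hxΓ h)
        filter_upwards [h2, ((hη n).eventuallyEq_one h1).deriv] with y hy hy'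
        rw [hy, hy']
        simp
    obtain ⟨p, hp⟩ := exists_ae_eq_of_hasCompactSupport hχ.continuous hχs
    obtain ⟨q, hq⟩ := exists_ae_eq_of_hasCompactSupport
      (G := fun x => -deriv (deriv fun x => η n x * jumpAt x₀ κ P x) x)
      hχ.deriv_infty.deriv_infty.continuous.neg hχs.deriv.deriv.neg
    obtain ⟨y, hy, hAy⟩ := apply_eq_of_mem_graph
      (hA.cutoff_mem_graph hclosed hnull hχ hχs hχΓ hp hq)
    have h1 := inner_apply_eq_of_isSelfAdjoint hA.selfAdjoint y u
    rw [hAy, hy, inner_eq_integral_of_ae_eq _ hq, inner_eq_integral_of_ae_eq _ hp] at h1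
    obtain ⟨hgi, hg⟩ := integral_excision_green (hη n) hδ hnr hP hfm fun x hx hxr =>
      hr' ⟨by rwa [Metric.mem_ball, Real.dist_eq], hx⟩
    obtain ⟨z, hz⟩ := exists_ae_eq_of_hasCompactSupport
      (G := fun x => η n x * -deriv (deriv P) x)
      (hsm.continuous.mul hP.deriv_infty.deriv_infty.continuous.neg) hPs.deriv.neg.mul_left
    have hzi := integrable_mul_of_ae_eq (u : L2R) hz
    have h2 : ∫ x, ((-deriv (deriv fun x => η n x * jumpAt x₀ κ P x) x : ℝ) : ℂ) * (u : L2R) x =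
        ∫ x, (((η n x * -deriv (deriv P) x : ℝ) : ℂ) * (u : L2R) x -
          ((deriv (deriv (η n)) x * jumpAt x₀ κ P x + 2 * (deriv (η n) x * deriv P x) : ℝ) : ℂ)
            * f x) := by
      refine integral_congr_ae ?_
      filter_upwards [huf] with x hx
      rw [hx, deriv_deriv_mul_jumpAt hP hsm h0]
      push_cast
      ring
    rw [h2, integral_sub hzi hgi, hg] at h1
    have h3 : ∫ x, (η n x : ℂ) * (((-deriv (deriv P) x : ℝ) : ℂ) * (u : L2R) x) =
        ∫ x, ((η n x * -deriv (deriv P) x : ℝ) : ℂ) * (u : L2R) x :=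
      integral_congr_ae (ae_of_all _ fun x => by push_cast; ring)
    have h4 : ∫ x, (η n x : ℂ) * ((jumpAt x₀ κ P x : ℂ) * (A u) x) =
        ∫ x, ((η n x * jumpAt x₀ κ P x : ℝ) : ℂ) * (A u) x :=
      integral_congr_ae (ae_of_all _ fun x => by push_cast; ring)
    rw [h3, h4, ← h1]
    ring
  rw [inner_eq_integral_of_ae_eq _ hw, inner_eq_integral_of_ae_eq _ hv]
  have := tendsto_nhds_unique (hlim0.neg.congr' hseq) (hlim1.sub hlim2)
  rw [neg_zero] at this
  exact (sub_eq_zero.1 this.symm).symm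

/-! ### Construction of the trial functions -/

theorem integral_jumpAt_mul_deriv {x₀ κ : ℝ} {P g : ℝ → ℝ} (hP : ContDiff ℝ ∞ P)
    (hg : ContDiff ℝ ∞ g) (hs : HasCompactSupport g) :
    ∫ x, jumpAt x₀ κ P x * deriv g x = -(∫ x, deriv P x * g x) - κ * g x₀ := by
  have e : (fun x => jumpAt x₀ κ P x * deriv g x) =
      fun x => P x * deriv g x + (Ioi x₀).indicator (fun x => κ * deriv g x) x := by
    funext x
    rw [jumpAt, add_mul]
    by_cases hx : x ∈ Ioi x₀ <;> simp [hx]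
  have hi : Integrable (deriv g) :=
    hg.deriv_infty.continuous.integrable_of_hasCompactSupport hs.deriv
  rw [e, integral_add, integral_mul_deriv_eq_neg hP hg hs, integral_indicator measurableSet_Ioi,
    integral_const_mul, HasCompactSupport.integral_Ioi_deriv_eq (hg.of_le (by simp)) hs]
  · ring
  · exact (hP.continuous.mul hg.deriv_infty.continuous).integrable_of_hasCompactSupport
      hs.deriv.mul_left
  · exact (hi.const_mul κ).indicator measurableSet_Ioi

/-- The primitive starting left of the support vanishes there; on the far right it equals `∫ h`,
which the jump `κ` cancels. -/
theorem exists_primitive_hasCompactSupport_jumpAt {h : ℝ → ℝ} (hh : ContDiff ℝ ∞ h)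
    (hs : HasCompactSupport h) (x₀ κ : ℝ) (hint : (∫ x, h x) + κ = 0) :
    ∃ P : ℝ → ℝ, ContDiff ℝ ∞ P ∧ deriv P = h ∧ HasCompactSupport (jumpAt x₀ κ P) := by
  obtain ⟨M, hM⟩ := hs.isCompact.isBounded.subset_ball 0
  set a := max M (|x₀| + 1) with ha
  have hzero : ∀ y, a ≤ |y| → h y = 0 := by
    intro y hy
    refine image_eq_zero_of_notMem_tsupport fun hy' => ?_
    have := hM hy'
    rw [Metric.mem_ball, Real.dist_eq, sub_zero] at this
    exact (this.trans_le ((le_max_left _ _).trans hy)).false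
  have hx₀ : |x₀| < a := (lt_add_one _).trans_le (le_max_right _ _)
  have ha0 : 0 < a := (abs_nonneg _).trans_lt hx₀
  have hd : ∀ x, HasDerivAt (fun x => ∫ y in (-a)..x, h y) (h x) x := fun x =>
    intervalIntegral.integral_hasDerivAt_right (hh.continuous.intervalIntegrable _ _)
      hh.continuous.stronglyMeasurable.stronglyMeasurableAtFilter hh.continuous.continuousAt
  have hderiv : (deriv fun x => ∫ y in (-a)..x, h y) = h := funext fun x => (hd x).deriv
  refine ⟨fun x => ∫ y in (-a)..x, h y, ?_, hderiv, ?_⟩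
  · rw [contDiff_infty_iff_deriv, hderiv]
    exact ⟨fun x => (hd x).differentiableAt, hh⟩
  · refine HasCompactSupport.intro (isCompact_Icc (a := -a) (b := a)) fun x hx => ?_
    rcases lt_or_ge x (-a) with h1 | h1
    · rw [jumpAt_of_le (by linarith [neg_abs_le x₀])]
      have : EqOn h (fun _ => 0) (uIcc (-a) x) := by
        intro y hy
        rw [uIcc_of_ge h1.le] at hy
        exact hzero y (by rw [abs_of_nonpos (by linarith [hy.2])]; linarith [hy.2])
      rw [intervalIntegral.integral_congr this, intervalIntegral.integral_zero]
    · have h2 : a < x := by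
        by_contra h2
        exact hx ⟨h1, not_lt.1 h2⟩
      rw [jumpAt_of_lt (by linarith [le_abs_self x₀]),
        intervalIntegral.integral_eq_integral_of_support_subset, hint]
      intro y hy
      have h3 : |y| < a := by
        by_contra h3
        exact hy (hzero y (not_lt.1 h3))
      exact ⟨(abs_lt.1 h3).1, ((abs_lt.1 h3).2.trans h2).le⟩

/-- A compactly supported profile with prescribed integral, value `1` at `x₀` and small `L₂` norm,
made of a narrow bump at `x₀` and a wide bump at a remote point `c`. -/
theorem exists_profile {x₀ c ε r b : ℝ} (hε : 0 < ε) (hb : 0 < b) (hbr : b < r)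
    (hdisj : ∀ x, |x - x₀| ≤ ε → r + 1 < |x - c|) :
    ∃ h : ℝ → ℝ, ContDiff ℝ ∞ h ∧ HasCompactSupport h ∧
      (∀ x ∈ tsupport h, |x - x₀| ≤ ε ∨ |x - c| ≤ r + 1) ∧ h x₀ = 1 ∧ ∫ x, h x = b ∧
      ∫ x, h x * h x < b := by
  have hr : 0 < r := hb.trans hbr
  -- The narrow bump then has integral at most `b / 4`. The wide one contributes at most `m ^ 2 / ∫
  -- ψ < b / 2` to the `L₂` norm squared, because `∫ ψ ≥ 2 r > 2 b`.
  set ρ := min ε (b / 8) with hρ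
  have hρ0 : 0 < ρ := lt_min hε (by positivity)
  let φ : ContDiffBump x₀ := ⟨ρ / 2, ρ, by positivity, by linarith⟩
  let ψ : ContDiffBump c := ⟨r, r + 1, hr, by linarith⟩
  have hφψ : ∀ x, φ x * ψ x = 0 := by
    intro x
    by_cases hx : |x - x₀| ≤ ε
    · rw [ψ.zero_of_le_dist (by rw [Real.dist_eq]; exact (hdisj x hx).le), mul_zero]
    · rw [φ.zero_of_le_dist, zero_mul]
      rw [Real.dist_eq]
      exact (min_le_left _ _).trans (not_le.1 hx).le
  have hφi : ∫ x, φ x ≤ 2 * ρ := by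
    have := φ.integral_le_measure_closedBall volume
    rwa [Real.volume_real_closedBall hρ0.le] at this
  have hφ0 : 0 ≤ ∫ x, φ x := integral_nonneg fun _ => φ.nonneg
  have hψi : 2 * r ≤ ∫ x, ψ x := by
    have := ψ.measure_closedBall_le_integral volume
    rwa [Real.volume_real_closedBall hr.le] at this
  have hρb : ρ ≤ b / 8 := min_le_right _ _
  have hφc : Continuous φ := φ.continuous
  have hψc : Continuous ψ := ψ.continuous
  have hφI : Integrable φ := hφc.integrable_of_hasCompactSupport φ.hasCompactSupport
  have hψI : Integrable ψ := hψc.integrable_of_hasCompactSupport ψ.hasCompactSupport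
  set m := b - ∫ x, φ x with hm
  set t := m / ∫ x, ψ x with ht
  have hψpos : 0 < ∫ x, ψ x := by linarith
  have hsm : ContDiff ℝ ∞ fun x => φ x + t * ψ x := φ.contDiff.add (contDiff_const.mul ψ.contDiff)
  refine ⟨fun x => φ x + t * ψ x, hsm, φ.hasCompactSupport.add ψ.hasCompactSupport.mul_left,
    fun x hx => ?_, ?_, ?_, ?_⟩
  · have hx' := tsupport_add (f := φ) (g := fun x => t * ψ x) hx
    rcases hx' with hx' | hx'
    · left
      rw [φ.tsupport_eq, Metric.mem_closedBall, Real.dist_eq] at hx'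
      exact hx'.trans (min_le_left _ _)
    · right
      have := tsupport_mul_subset_right (f := fun _ => t) (g := ψ) hx'
      rwa [ψ.tsupport_eq, Metric.mem_closedBall, Real.dist_eq] at this
  · have h1 : φ x₀ = 1 :=
      φ.one_of_mem_closedBall (Metric.mem_closedBall_self φ.rIn_pos.le)
    have h2 := hφψ x₀
    rw [h1, one_mul] at h2
    simp only [h1, h2, mul_zero, add_zero]
  · rw [integral_add hφI (hψI.const_mul t), integral_const_mul, ht, div_mul_cancel₀ _ hψpos.ne']
    ring
  · have hle : ∀ x, (φ x + t * ψ x) * (φ x + t * ψ x) ≤ φ x + t ^ 2 * ψ x := by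
      intro x
      have e : (φ x + t * ψ x) * (φ x + t * ψ x) =
          φ x * φ x + t ^ 2 * (ψ x * ψ x) + 2 * t * (φ x * ψ x) := by ring
      rw [e, hφψ, mul_zero, add_zero]
      exact add_le_add (mul_le_of_le_one_left φ.nonneg φ.le_one)
        (mul_le_mul_of_nonneg_left (mul_le_of_le_one_left ψ.nonneg ψ.le_one) (sq_nonneg t))
    have h1 : ∫ x, (φ x + t * ψ x) * (φ x + t * ψ x) ≤ ∫ x, (φ x + t ^ 2 * ψ x) := by
      refine integral_mono ?_ (hφI.add (hψI.const_mul _)) hle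
      exact (hsm.continuous.mul hsm.continuous).integrable_of_hasCompactSupport
        (φ.hasCompactSupport.add ψ.hasCompactSupport.mul_left).mul_left
    refine h1.trans_lt ?_
    rw [integral_add hφI (hψI.const_mul _), integral_const_mul]
    have e : t ^ 2 * ∫ x, ψ x = m ^ 2 / ∫ x, ψ x := by
      rw [ht]
      field_simp
    have h2 : m ^ 2 / ∫ x, ψ x < b / 2 := by
      rw [div_lt_iff₀ hψpos]
      have : m ^ 2 ≤ b ^ 2 := pow_le_pow_left₀ (by linarith) (by linarith) 2
      nlinarith
    rw [e]
    linarith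

theorem IsIsolatedPoint.exists_pos {Γ : Set ℝ} {x₀ : ℝ} (h : IsIsolatedPoint Γ x₀) :
    ∃ ε > 0, ∀ x ∈ Γ, |x - x₀| < ε → x = x₀ := by
  have h1 := h.2
  rw [accPt_iff_frequently, not_frequently] at h1
  obtain ⟨ε, hε, h2⟩ := Metric.eventually_nhds_iff.1 h1
  refine ⟨ε, hε, fun x hx hxε => ?_⟩
  by_contra hne
  exact h2 (y := x) (by rwa [Real.dist_eq]) ⟨hne, hx⟩

/-- Finitely many points of negative intensity produce profiles with disjoint supports. -/
theorem exists_disjoint_profiles {Γ : Set ℝ} (hΓ : Bornology.IsBounded Γ) {N : ℕ} {x β : Fin N → ℝ}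
    (hx : Function.Injective x) (hiso : ∀ k, IsIsolatedPoint Γ (x k)) (hβ : ∀ k, β k < 0) :
    ∃ h : Fin N → ℝ → ℝ, (∀ k, ContDiff ℝ ∞ (h k)) ∧ (∀ k, HasCompactSupport (h k)) ∧
      (∀ k, ∀ y ∈ Γ, y ∈ tsupport (h k) → y = x k) ∧ (∀ k, h k (x k) = 1) ∧
      (∀ k, ∫ y, h k y = -β k) ∧ (∀ k, ∫ y, h k y * h k y < -β k) ∧
      ∀ j k, j ≠ k → ∀ y, h j y * h k y = 0 := by
  choose ε hε hiso' using fun k => (hiso k).exists_pos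
  obtain ⟨B, hB⟩ := hΓ.subset_closedBall 0
  have hB' : ∀ y ∈ Γ, |y| ≤ B := fun y hy => by
    have := hB hy
    rwa [Metric.mem_closedBall, Real.dist_eq, sub_zero] at this
  set r := 1 + ∑ k, -β k with hr
  have hβr : ∀ k, -β k < r := fun k => by
    have := Finset.single_le_sum (f := fun k => -β k) (fun i _ => by linarith [hβ i])
      (Finset.mem_univ k)
    linarith
  have hr1 : 1 ≤ r := by
    have : 0 ≤ ∑ k, -β k := Finset.sum_nonneg fun k _ => by linarith [hβ k]
    linarith
  -- The wide bumps have radius `r + 1`. The spacing `2 r + 3` separates them from each other, from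
  -- `Γ`, and from the narrow bumps, which stay below `B + 1`.
  let c : Fin N → ℝ := fun k => B + ((k : ℕ) + 1) * (2 * r + 3)
  have hc : ∀ k, B + 2 * r + 3 ≤ c k := fun k => by
    have : (0 : ℝ) ≤ (k : ℕ) := Nat.cast_nonneg _
    simp only [c]
    nlinarith
  have hcc : ∀ j k, j ≠ k → 2 * r + 3 ≤ |c j - c k| := by
    intro j k hjk
    have e : c j - c k = (((j : ℕ) : ℤ) - ((k : ℕ) : ℤ) : ℤ) * (2 * r + 3) := by
      simp only [c]
      push_cast
      ring
    have h1 : (1 : ℤ) ≤ |((j : ℕ) : ℤ) - ((k : ℕ) : ℤ)| :=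
      Int.one_le_abs (by have := Fin.val_ne_of_ne hjk; omega)
    have h2 : (1 : ℝ) ≤ |((((j : ℕ) : ℤ) - ((k : ℕ) : ℤ) : ℤ) : ℝ)| := by
      rw [← Int.cast_abs]
      exact_mod_cast h1
    rw [e, abs_mul, abs_of_pos (by linarith : 0 < 2 * r + 3)]
    nlinarith
  have hxx : ∀ j k, j ≠ k → ε j ≤ |x j - x k| ∧ ε k ≤ |x j - x k| := by
    intro j k hjk
    constructor
    · rw [abs_sub_comm]
      exact not_lt.1 fun h => hjk (hx (hiso' j _ (hiso k).1 h)).symm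
    · exact not_lt.1 fun h => hjk (hx (hiso' k _ (hiso j).1 h))
  -- Distinct points are at least `max (ε j) (ε k)` apart, which exceeds the sum of two
  -- thirds-radii, so the narrow bumps are disjoint.
  let ρ : Fin N → ℝ := fun k => min (ε k / 3) 1
  have hρ : ∀ k, 0 < ρ k ∧ ρ k ≤ ε k / 3 ∧ ρ k ≤ 1 := fun k =>
    ⟨lt_min (by linarith [hε k]) one_pos, min_le_left _ _, min_le_right _ _⟩
  have hxB : ∀ k, x k ≤ B := fun k => (le_abs_self _).trans (hB' _ (hiso k).1)
  have hfar : ∀ j k y, |y - x j| ≤ ρ j → r + 1 < |y - c k| := by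
    intro j k y hy
    have h1 := (abs_le.1 hy).2
    have h2 := hc k
    have h3 := hxB j
    have h4 := (hρ j).2.2
    rw [abs_sub_comm]
    exact lt_of_lt_of_le (by linarith) (le_abs_self _)
  choose h h1 h2 h3 h4 h5 h6 using fun k =>
    exists_profile (hρ k).1 (by linarith [hβ k] : 0 < -β k) (hβr k) (hfar k k)
  refine ⟨h, h1, h2, fun k y hy hyk => ?_, h4, h5, h6, fun j k hjk y => ?_⟩
  · rcases h3 k y hyk with h | h
    · exact hiso' k y hy (by linarith [(hρ k).2.1, hε k])
    · have := (abs_le.1 h).1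
      have := hc k
      have := (le_abs_self y).trans (hB' y hy)
      linarith
  · by_contra hne
    have hj := h3 j y (subset_tsupport _ (left_ne_zero_of_mul hne))
    have hk := h3 k y (subset_tsupport _ (right_ne_zero_of_mul hne))
    rcases hj with hj | hj <;> rcases hk with hk | hk
    · have h7 := abs_sub_le (x j) y (x k)
      rw [abs_sub_comm (x j) y] at h7
      obtain ⟨h8, h9⟩ := hxx j k hjk
      linarith [(hρ j).2.1, (hρ k).2.1, hε j, hε k]
    · exact absurd (hfar j k y hj) hk.not_gt
    · exact absurd (hfar k j y hk) hj.not_gt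
    · have h7 := abs_sub_le (c j) y (c k)
      rw [abs_sub_comm (c j) y] at h7
      linarith [hcc j k hjk]

/-! ### The diagonal negative form and the count -/

theorem card_le_numNegativeEigenvalues {Γ : Set ℝ} (hclosed : IsClosed Γ)
    (hbounded : Bornology.IsBounded Γ) (hnull : volume Γ = 0) {A : L2R →ₗ.[ℂ] L2R}
    (hA : IsDeltaPrimeInteraction Γ A) (hdiscrete : NegativeSpectrumDiscrete A) {N : ℕ}
    {x β : Fin N → ℝ} (hx : Function.Injective x) (hiso : ∀ k, IsIsolatedPoint Γ (x k))
    (hβ : ∀ k, β k < 0) (hint : ∀ k, HasIntensity A (x k) (β k)) :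
    (N : ℕ∞) ≤ numNegativeEigenvalues A := by
  obtain ⟨h, hsm, hs, hsupp, hone, hh, hhh, hdisj⟩ := exists_disjoint_profiles hbounded hx hiso hβ
  choose P hP hPd hPs using fun k => exists_primitive_hasCompactSupport_jumpAt (hsm k) (hs k) (x k)
    (β k) (by rw [hh]; ring)
  choose ε hε hiso' using fun k => (hiso k).exists_pos
  choose w hw using fun k => exists_ae_eq_jumpAt (hP k).continuous (hPs k)
  choose v hv using fun k => exists_ae_eq_of_hasCompactSupport (G := fun y => -deriv (h k) y)
    (hsm k).deriv_infty.continuous.neg (hs k).deriv.neg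
  have hgraph : ∀ k, (w k, v k) ∈ A.graph := by
    intro k
    have e : β k * deriv (P k) (x k) = β k := by rw [hPd, hone, mul_one]
    refine hA.jumpAt_mem_graph hclosed hnull (hε k) (hiso' k) (hint k) (hP k) ?_ ?_ ?_ ?_ ?_
    · rw [hPd]; exact hs k
    · rw [e]; exact hPs k
    · rw [hPd]; exact hsupp k
    · rw [e]; exact hw k
    · rw [hPd]; exact hv k
  choose f hf hAf using fun k => apply_eq_of_mem_graph (hgraph k)
  have hinner : ∀ j k, inner ℂ (f j : L2R) (A (f k)) =
      (((∫ y, h j y * h k y) + β j * h k (x j) : ℝ) : ℂ) := by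
    intro j k
    rw [hf, hAf, inner_eq_integral_of_ae_eq _ (hw j)]
    have e : ∫ y, (jumpAt (x j) (β j) (P j) y : ℂ) * v k y =
        ∫ y, ((-(jumpAt (x j) (β j) (P j) y * deriv (h k) y) : ℝ) : ℂ) := by
      refine integral_congr_ae ?_
      filter_upwards [hv k] with y hy
      rw [hy]
      push_cast
      ring
    rw [e, integral_complex_ofReal, integral_neg,
      integral_jumpAt_mul_deriv (hP j) (hsm k) (hs k), hPd]
    congr 1
    ring
  refine le_numNegativeEigenvalues hA.selfAdjoint hdiscrete f (fun j k hjk => ?_) fun k => ?_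
  · have h0 : h k (x j) = 0 := by
      have := hdisj j k hjk (x j)
      rwa [hone, one_mul] at this
    rw [hinner, h0]
    simp only [hdisj j k hjk, integral_zero, mul_zero, add_zero, Complex.ofReal_zero]
  · rw [hinner, Complex.ofReal_re, hone, mul_one]
    linarith [hhh k]

end DeltaPrime

theorem theorem1 (Γ : Set ℝ) (hclosed : IsClosed Γ) (hbounded : Bornology.IsBounded Γ)
    (hnull : MeasureTheory.volume Γ = 0)
    (A : DeltaPrime.L2R →ₗ.[ℂ] DeltaPrime.L2R)
    (hA : DeltaPrime.IsDeltaPrimeInteraction Γ A)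
    (hdiscrete : DeltaPrime.NegativeSpectrumDiscrete A) :
    (DeltaPrime.negativeIntensityPoints Γ A).encard ≤ DeltaPrime.numNegativeEigenvalues A := by
  -- An infinite set of points is handled through its finite subsets of every size `N`.
  refine ENat.forall_natCast_le_iff_le.1 fun N hN => ?_
  obtain ⟨S, hS, hcard⟩ := Set.exists_subset_encard_eq hN
  have hfin : S.Finite := Set.finite_of_encard_eq_coe hcard
  have hN' : hfin.toFinset.card = N := by
    rw [hfin.encard_eq_coe_toFinset_card] at hcard
    exact_mod_cast hcard
  let e := hfin.toFinset.equivFinOfCardEq hN'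
  have hmem : ∀ k, ((e.symm k : hfin.toFinset) : ℝ) ∈ DeltaPrime.negativeIntensityPoints Γ A :=
    fun k => hS (hfin.mem_toFinset.1 (e.symm k).2)
  choose hiso β hβ hint using hmem
  exact DeltaPrime.card_le_numNegativeEigenvalues hclosed hbounded hnull hA hdiscrete
    (Subtype.val_injective.comp e.symm.injective) hiso hβ hint
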